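/- Let $k$ be a field and let $n\ge 1$, $m\ge 3$ be integers. Let $Q_0$ be the set of all $\mathbf i=(i_1,\dots,i_n)\in\mathbb Z^n$ with $i_t\ge 1$ for all $t$ and $\sum_{t=1}^s i_t\le m+s-1$ for $1\le s\le n$. For $1\le t\le n+1$ put $\mathbf i(1)=\mathbf i+\mathbf e_1$ if $t=1$, $\mathbf i(t)=\mathbf i-\mathbf e_{t-1}+\mathbf e_t$ if $2\le t\le n$, and $\mathbf i(n+1)=\mathbf i-\mathbf e_n$ if $t=n+1$ (so for $n=1$: $\mathbf i(1)=\mathbf i+\mathbf e_1$, $\mathbf i(2)=\mathbf i-\mathbf e_1$). The stable $n$-cubic pyramid quiver $\tilde Q(n)$ of height $m$ has vertex set $Q_0$ and one arrow $\gamma^{(t)}_{\mathbf i}:\mathbf i\to\mathbf i(t)$ whenever $\mathbf i,\mathbf i(t)\in Q_0$, $1\le t\le n+1$. Let scalars $d_{s,t,\mathbf i}\in k$ ($1\le t<s\le n+1$) be given which satisfy: (i) $d_{s,t,\mathbf i}\ne 0$ whenever $\mathbf i,\mathbf i(t),\mathbf i(s),\mathbf i(t)(s)\in Q_0$; (ii)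 for $r<t<s$ and every $\mathbf i$ such that all vertices of the cube spanned at $\mathbf i$ by the directions $r,t,s$ lie in $Q_0$, $$d_{t,r,\mathbf i}\,d_{s,r,\mathbf i(t)}\,d_{s,t,\mathbf i}=d_{t,r,\mathbf i(s)}\,d_{s,t,\mathbf i(r)}\,d_{s,r,\mathbf i}.$$ Let $\tilde\Lambda$ be the path algebra $k\tilde Q(n)$ (paths composed from right to left) modulo the relations $\gamma^{(t)}_{\mathbf i(t)}\gamma^{(t)}_{\mathbf i}=0$ for all composable arrows of the same type, and $d_{s,t,\mathbf i}\,\gamma^{(t)}_{\mathbf i(s)}\gamma^{(s)}_{\mathbf i}=\gamma^{(s)}_{\mathbf i(t)}\gamma^{(t)}_{\mathbf i}$ for all $t<s$ and $\mathbf i$ with $\mathbf i,\mathbf i(t),\mathbf i(s),\mathbf i(t)(s)\in Q_0$. Modules are left modules; $\tilde P(\mathbf j)=\tilde\Lambda e_{\mathbf j}$, and $\tilde S(\mathbf j)$ is the quotient of $\tilde P(\mathbf j)$ by the submodule generated by the arrows starting at $\mathbf j$. Fix $\mathbf i\in Q_0$. Put $\mathbf b=\mathbf b(\mathbf i)=(m+n-1-\sum_t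 i_t,\ i_1-1,\dots,i_n-1)$, and for $\mathbf a\in\mathbb Z^{n+1}$ put $\mathbf v^{\mathbf i}(\mathbf a)=(i_1+a_1-a_2,\dots,i_n+a_n-a_{n+1})$ and $|\mathbf a|=\sum_t a_t$. Let $C_l=C^{(n)}_l(\mathbf i)$ be the set of integral points $\mathbf a$ of the cuboid $0\le a_t\le b_t$ ($1\le t\le n+1$) with $|\mathbf a|=l$. Write $\mathbf e_t$ also for the standard basis vectors of $\mathbb Z^{n+1}$ and $\mathbf e=(1,\dots,1)$. Then $C_{m-1}=\{\mathbf b\}$, $\mathbf v^{\mathbf i}(\mathbf b+\mathbf e)=\mathbf v^{\mathbf i}(\mathbf b)\in Q_0$, and $\mathbf v^{\mathbf i}(\mathbf a)\in Q_0$ for all $\mathbf a\in C_l$, $0\le l\le m-1$. Let $\tilde P^l=\bigoplus_{\mathbf a\in C_l}\tilde P(\mathbf v^{\mathbf i}(\mathbf a))$ with standard generators $\varepsilon^{(l)}_{\mathbf a}$ (and $\varepsilon^{(l)}_{\mathbf a}=0$ for $\mathbf a\notin C_l$). There are scalars $\zeta^{(l-1)}_{\mathbf a,t}\in k$ for $1\le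 l\le m-1$, $\mathbf a\in C_l$, $1\le t\le n+1$, with $\zeta^{(l-1)}_{\mathbf a,t}\neq 0$ if and only if $\mathbf a-\mathbf e_t\in C_{l-1}$, such that, with $$\theta^{(l-1)}_{\mathbf a}=\sum_{t=1}^{n+1}\zeta^{(l-1)}_{\mathbf a,t}\,\gamma^{(t)}_{\mathbf v^{\mathbf i}(\mathbf a-\mathbf e_t)}\,\varepsilon^{(l-1)}_{\mathbf a-\mathbf e_t}\in\tilde P^{l-1},$$ the following hold. 1. $e_{\mathbf v^{\mathbf i}(\mathbf a)}\theta^{(l-1)}_{\mathbf a}=\theta^{(l-1)}_{\mathbf a}$, and there are $\tilde\Lambda$-linear maps $f_0:\tilde P^0\to\tilde S(\mathbf i)$ and $f_l:\tilde P^l\to\tilde P^{l-1}$ ($1\le l\le m-1$) such that $f_0(\varepsilon^{(0)}_{0})$ is the class of $e_{\mathbf i}$ and $f_l(\varepsilon^{(l)}_{\mathbf a})=\theta^{(l-1)}_{\mathbf a}$ for $\mathbf a\in C_l$. If the generators of $\tilde P^l$ are placed in degree $l$ and arrows have degree $1$, the maps $f_l$, $l\ge1$, are homogeneous of degree $0$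 (linearity). 2. $\tilde P^{m-1}\xrightarrow{f_{m-1}}\cdots\xrightarrow{f_1}\tilde P^0\xrightarrow{f_0}\tilde S(\mathbf i)\to0$ is the beginning of a minimal projective resolution of $\tilde S(\mathbf i)$: the terms are projective, the sequence is exact, and $\operatorname{Ker} f_l$ is superfluous in $\tilde P^l$ for $0\le l\le m-1$. 3. $\operatorname{Ker} f_l$ is generated by $\{\theta^{(l)}_{\mathbf a}\mid\mathbf a\in C_{l+1}\}$ for $0\le l\le m-2$. 4. $\operatorname{Ker} f_{m-1}$ is a simple module isomorphic to $\tilde S(\mathbf v^{\mathbf i}(\mathbf b))$. 5. For the first $m$ terms $P^{m-1}\to\cdots\to P^0\to\tilde S(\mathbf i)\to 0$ of any minimal projective resolution of $\tilde S(\mathbf i)$ there are isomorphisms $\tilde P^l\to P^l$, $0\le l\le m-1$, commuting with the differentials and with the maps to $\tilde S(\mathbf i)$; in particular the kernel of $P^{m-1}\to P^{m-2}$ is isomorphic to $\tilde S(\mathbf v^{\mathbf i}(\mathbf b))$. -/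

import Mathlib

/-!
Stable pyramid algebras of cubic type, the cuboid attached to a vertex, and minimal projective
resolutions. Components and arrow types are indexed from `0`: component `s : Fin n` stands for the
component `s + 1` of an integral vector, and `t : Fin (n + 1)` for the arrow type `t + 1`. Paths are
composed from right to left, and modules are left modules.
-/

namespace CubicPyramid

open scoped DirectSum

/-- The vertex set of the pyramid quiver of height `m`: all components are at least `1`, and the sum
of the first `s` components is at most `m + s - 1`, for `1 ≤ s ≤ n`. -/
def IsVertex {n : ℕ} (m : ℕ) (i : Fin n → ℤ) : Prop :=
  (∀ t, 1 ≤ i t) ∧ ∀ s : Fin n, ∑ t ∈ Finset.Iic s, i t ≤ (m : ℤ) + (s : ℕ)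

/-- The point `v^i(a) = (i_1 + a_1 - a_2, …, i_n + a_n - a_{n+1})`. -/
def shift {n : ℕ} (i : Fin n → ℤ) (a : Fin (n + 1) → ℤ) : Fin n → ℤ :=
  fun s => i s + a s.castSucc - a s.succ

/-- The `t`-th standard basis vector. -/
def basisVec {n : ℕ} (t : Fin (n + 1)) : Fin (n + 1) → ℤ := Pi.single t 1

/-- The possible end point of an arrow of type `t` starting at `i`: it is `i + e_1` for type `1`,
`i - e_{t-1} + e_t` for the types `2 ≤ t ≤ n`, and `i - e_n` for type `n + 1`. -/
def step {n : ℕ} (t : Fin (n + 1)) (i : Fin n → ℤ) : Fin n → ℤ := shift i (basisVec t)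

/-- Vertices of the (stable) pyramid quiver. -/
abbrev Vertex (n m : ℕ) : Type := {i : Fin n → ℤ // IsVertex m i}

/-- Arrows of the stable pyramid quiver: there is one arrow of type `t` from `i` to `step t i`
whenever both are vertices. -/
abbrev Arrow (n m : ℕ) : Type :=
  {p : Fin (n + 1) × (Fin n → ℤ) // IsVertex m p.2 ∧ IsVertex m (step p.1 p.2)}

theorem finite_vertex (n m : ℕ) : Finite (Vertex n m) := by
  have hsub : {i : Fin n → ℤ | IsVertex m i} ⊆
      Set.Icc (fun _ => (1 : ℤ)) (fun _ => (m : ℤ) + n) := by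
    intro i hi
    refine ⟨fun t => hi.1 t, fun t => ?_⟩
    have h1 : i t ≤ ∑ s ∈ Finset.Iic t, i s :=
      Finset.single_le_sum (f := i) (fun s _ => by have := hi.1 s; omega) (by simp)
    have h2 := hi.2 t
    have h3 : ((t : ℕ) : ℤ) < n := by exact_mod_cast t.2
    show i t ≤ (m : ℤ) + n
    omega
  exact ((Set.finite_Icc _ _).subset hsub).to_subtype

noncomputable instance (n m : ℕ) : Fintype (Vertex n m) :=
  @Fintype.ofFinite _ (finite_vertex n m)

/-- Scalar data `d_{s,t,i}` for the commutativity relations (only `t < s` is used). -/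
abbrev Coeff (k : Type*) (n : ℕ) : Type _ := Fin (n + 1) → Fin (n + 1) → (Fin n → ℤ) → k

/-- The vertices `i`, `i(t)`, `i(s)`, `i(t)(s)` all belong to the quiver. -/
def IsSquare {n : ℕ} (m : ℕ) (s t : Fin (n + 1)) (i : Fin n → ℤ) : Prop :=
  IsVertex m i ∧ IsVertex m (step t i) ∧ IsVertex m (step s i) ∧ IsVertex m (step s (step t i))

/-- Admissible scalars: the scalar of every commutative square is nonzero, and moving arrows of type
`s` past arrows of smaller type, `x ↦ d_{s,x} x`, sends the commutativity relation of the types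
`r < t` at `i` to a multiple of the commutativity relation at `i(s)`. The hypotheses of
`multiplicative` say that `i` spans a full cube in the directions `r, t, s`. -/
structure IsAdmissible {k : Type*} [Field k] {n : ℕ} (m : ℕ) (d : Coeff k n) : Prop where
  ne_zero : ∀ s t i, t < s → IsSquare m s t i → d s t i ≠ 0
  multiplicative : ∀ r t s i, r < t → t < s →
    IsSquare m t r i → IsSquare m s r i → IsSquare m s t i →
    IsSquare m t r (step s i) → IsSquare m s r (step t i) → IsSquare m s t (step r i) →
      d t r i * (d s r (step t i) * d s t i) = d t r (step s i) * (d s t (step r i) * d s r i)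

section Algebra

variable {k : Type*} [Field k] {n : ℕ}

/-- The free generator at a vertex, and `0` off the vertex set. -/
noncomputable def freeIdem (k : Type*) [Field k] {n : ℕ} (m : ℕ) (i : Fin n → ℤ) :
    FreeAlgebra k (Vertex n m ⊕ Arrow n m) :=
  open Classical in if h : IsVertex m i then FreeAlgebra.ι k (Sum.inl ⟨i, h⟩) else 0

/-- The free generator at the arrow of type `t` starting at `i`, and `0` if there is none. -/
noncomputable def freeArrow (k : Type*) [Field k] {n : ℕ} (m : ℕ) (t : Fin (n + 1))
    (i : Fin n → ℤ) : FreeAlgebra k (Vertex n m ⊕ Arrow n m) :=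
  open Classical in
  if h : IsVertex m i ∧ IsVertex m (step t i) then FreeAlgebra.ι k (Sum.inr ⟨(t, i), h⟩) else 0

/-- The relations of the algebra. The first five constructors are those of the path algebra of the
(finite) stable pyramid quiver; the last two are the quadratic relations: arrows of the same type
compose to zero, and every square with all four vertices in the quiver commutes up to its scalar. -/
inductive Rel (m : ℕ) (d : Coeff k n) :
    FreeAlgebra k (Vertex n m ⊕ Arrow n m) → FreeAlgebra k (Vertex n m ⊕ Arrow n m) → Prop
  | idem_mul_self (i : Vertex n m) :
      Rel m d (freeIdem k m i.1 * freeIdem k m i.1) (freeIdem k m i.1)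
  | idem_mul_idem (i j : Vertex n m) (h : i ≠ j) :
      Rel m d (freeIdem k m i.1 * freeIdem k m j.1) 0
  | sum_idem : Rel m d (∑ i : Vertex n m, freeIdem k m i.1) 1
  | arrow_mul_source (a : Arrow n m) :
      Rel m d (freeArrow k m a.1.1 a.1.2 * freeIdem k m a.1.2) (freeArrow k m a.1.1 a.1.2)
  | target_mul_arrow (a : Arrow n m) :
      Rel m d (freeIdem k m (step a.1.1 a.1.2) * freeArrow k m a.1.1 a.1.2)
        (freeArrow k m a.1.1 a.1.2)
  | same_type (t : Fin (n + 1)) (i : Fin n → ℤ) (h₀ : IsVertex m i) (h₁ : IsVertex m (step t i))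
      (h₂ : IsVertex m (step t (step t i))) :
      Rel m d (freeArrow k m t (step t i) * freeArrow k m t i) 0
  | square (s t : Fin (n + 1)) (i : Fin n → ℤ) (hts : t < s) (h : IsSquare m s t i) :
      Rel m d (d s t i • (freeArrow k m t (step s i) * freeArrow k m s i))
        (freeArrow k m s (step t i) * freeArrow k m t i)

/-- The stable pyramid algebra: path algebra of the stable pyramid quiver modulo the quadratic
relations. -/
def StableAlg (m : ℕ) (d : Coeff k n) : Type _ := RingQuot (Rel m d)

noncomputable instance (m : ℕ) (d : Coeff k n) : Ring (StableAlg m d) :=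
  inferInstanceAs (Ring (RingQuot (Rel m d)))

noncomputable instance (m : ℕ) (d : Coeff k n) : Algebra k (StableAlg m d) :=
  inferInstanceAs (Algebra k (RingQuot (Rel m d)))

/-- The idempotent `e_i`; it is `0` if `i` is not a vertex. -/
noncomputable def idem (m : ℕ) (d : Coeff k n) (i : Fin n → ℤ) : StableAlg m d :=
  RingQuot.mkAlgHom k (Rel m d) (freeIdem k m i)

/-- The arrow of type `t` starting at `i`; it is `0` if there is none. -/
noncomputable def arrow (m : ℕ) (d : Coeff k n) (t : Fin (n + 1)) (i : Fin n → ℤ) :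
    StableAlg m d :=
  RingQuot.mkAlgHom k (Rel m d) (freeArrow k m t i)

/-- The span of all paths of length `p`. -/
noncomputable def homog (m : ℕ) (d : Coeff k n) : ℕ → Submodule k (StableAlg m d)
  | 0 => Submodule.span k (Set.range (idem m d))
  | p + 1 => Submodule.span k
      (Set.range fun q : Fin (n + 1) × (Fin n → ℤ) => arrow m d q.1 q.2) * homog m d p

/-- The indecomposable projective left module at `i`: the left ideal generated by `e_i`. -/
noncomputable abbrev Proj (m : ℕ) (d : Coeff k n) (i : Fin n → ℤ) :
    Submodule (StableAlg m d) (StableAlg m d) :=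
  Submodule.span (StableAlg m d) {idem m d i}

/-- The generator `e_i` of the projective at `i`. -/
noncomputable def projGen (m : ℕ) (d : Coeff k n) (i : Fin n → ℤ) : Proj m d i :=
  ⟨idem m d i, Submodule.subset_span rfl⟩

/-- The radical of the projective at `i`: the submodule generated by the arrows starting at `i`. -/
noncomputable def radProj (m : ℕ) (d : Coeff k n) (i : Fin n → ℤ) :
    Submodule (StableAlg m d) (Proj m d i) :=
  Submodule.span (StableAlg m d) {x | ∃ t, (x : StableAlg m d) = arrow m d t i}

/-- The simple module at `i`: the projective at `i` modulo its radical. -/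
abbrev Simple (m : ℕ) (d : Coeff k n) (i : Fin n → ℤ) : Type _ := Proj m d i ⧸ radProj m d i

end Algebra

section Cuboid

variable {n : ℕ}

/-- The side lengths `b(i) = (m + n - 1 - |i|, i_1 - 1, …, i_n - 1)` of the cuboid. -/
def sides (m : ℕ) (i : Fin n → ℤ) : Fin (n + 1) → ℤ :=
  Fin.cons ((m : ℤ) + n - 1 - ∑ t, i t) fun s => i s - 1

/-- The integral points `a` of the cuboid (that is, `0 ≤ a_t ≤ b_t(i)` for all `t`) such that
`|a| = l`. -/
noncomputable def cuboidNet (m : ℕ) (i : Fin n → ℤ) (l : ℕ) : Finset (Fin (n + 1) → ℤ) :=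
  (Finset.Icc 0 (sides m i)).filter fun a => ∑ t, a t = (l : ℤ)

end Cuboid

section Resolution

variable {k : Type*} [Field k] {n : ℕ}

/-- The direct sum of the projectives at `v^i(a)` over the points `a` of the cuboid with
`|a| = l`. -/
abbrev Term (m : ℕ) (d : Coeff k n) (i : Fin n → ℤ) (l : ℕ) : Type _ :=
  ⨁ a : cuboidNet m i l, Proj m d (shift i a.1)

/-- The standard generator of the summand with index `a`, and `0` if `a` is not an index. -/
noncomputable def gen (m : ℕ) (d : Coeff k n) (i : Fin n → ℤ) (l : ℕ) (a : Fin (n + 1) → ℤ) :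
    Term m d i l :=
  if h : a ∈ cuboidNet m i l then
    DirectSum.lof (StableAlg m d) (cuboidNet m i l)
      (fun a : cuboidNet m i l => Proj m d (shift i a.1)) ⟨a, h⟩ (projGen m d (shift i a))
  else 0

/-- The element `θ_a = ∑_t ζ_{a,t} γ^{(t)}_{v^i(a - e_t)} ε_{a - e_t}` of the `l`-th term. -/
noncomputable def theta (m : ℕ) (d : Coeff k n) (i : Fin n → ℤ) (l : ℕ)
    (ζ : (Fin (n + 1) → ℤ) → Fin (n + 1) → k) (a : Fin (n + 1) → ℤ) : Term m d i l :=
  ∑ t, (ζ a t • arrow m d t (shift i (a - basisVec t))) • gen m d i l (a - basisVec t)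

/-- A submodule is superfluous if it has no proper supplement. -/
def IsSuperfluous {R M : Type*} [Ring R] [AddCommGroup M] [Module R M] (N : Submodule R M) : Prop :=
  ∀ L : Submodule R M, N ⊔ L = ⊤ → L = ⊤

/-- `P q → ⋯ → P 1 → P 0 → S → 0` is the beginning of a minimal projective resolution of `S`. Here
`f l` is the map from `P (l + 1)` to `P l`; each `P l` with `l ≤ q` is a projective cover of the
image of the map leaving it. -/
structure IsMinimalResolutionUpTo {R S : Type*} [Ring R] [AddCommGroup S] [Module R S] (q : ℕ)
    {P : ℕ → Type*} [∀ l, AddCommGroup (P l)] [∀ l, Module R (P l)]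
    (ε : P 0 →ₗ[R] S) (f : ∀ l, P (l + 1) →ₗ[R] P l) : Prop where
  projective : ∀ l ≤ q, Module.Projective R (P l)
  surjective : Function.Surjective ε
  exact_zero : 0 < q → LinearMap.range (f 0) = LinearMap.ker ε
  exact_succ : ∀ l, l + 1 < q → LinearMap.range (f (l + 1)) = LinearMap.ker (f l)
  minimal_zero : IsSuperfluous (LinearMap.ker ε)
  minimal_succ : ∀ l < q, IsSuperfluous (LinearMap.ker (f l))

end Resolution

end CubicPyramid

open CubicPyramid

universe u w

/-!
# Minimal resolutions of the simple modules over stable pyramid algebras of cubic type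

In barycentric coordinates (`sides`) the vertices are the lattice points of the simplex of
`b ∈ ℕ ^ (n + 1)` with `|b| = m - 1`, and an arrow of type `t` moves one unit from the coordinate `t` to
the cyclically next one. A point `c` lies over a vertex, i.e. `shift i c` is a vertex, if and only
if `c t ≤ b t + c (t - 1)` for all `t`, where `b = sides m i`; such points form a distributive
lattice.

The scalars `d` become trivial on this lattice. By recursion on `|c|` every arrow above a
nonnegative point gets a nonzero factor `lam t c` which turns all commutativity scalars into `1`
(`lam_square`); consistency at each point is the cube condition. For a nonnegative point `a` over
a vertex, the rescaled arrows give one path element `path a c` for each point `c` over a vertex in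
the unit cube `a ≤ c ≤ a + 1`, and these elements form a basis of the projective at the vertex
below `a`. They span because longer paths repeat an arrow type and vanish
(`InCube.exists_sub_of_add`, which needs `m - 1 ≥ 2`), and they are independent because the
algebra acts on a space with the basis `c` (`exists_coord`).

With `ζ` the Koszul sign divided by `lam`, the differential sends the path from `a` to `c` to the
signed sum of the paths from `a - e_t` to `c` (`tcoord_diff`). The complex is therefore a direct
sum of complexes indexed by the end points `c`. If some coordinate of `c` satisfies
`1 ≤ c t ≤ b t`, then both `a t = c t` and `a t = c t - 1` are possible, and moving between them is a
contracting homotopy (`exists_diff_eq`). Otherwise `c` is `0` or `b + 1` (`eq_zero_or_eq_sides`):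
the first contributes the simple module at `i` in degree `0`, the second the one-dimensional
kernel at the last term.

The kernels contain no trivial paths, and the arrows act nilpotently, so the kernels are
superfluous by a form of Nakayama's lemma (`isSuperfluous_of_nilpotent`). Finally, projective
covers are unique, which gives the comparison with an arbitrary minimal resolution
(`IsMinimalResolutionUpTo.exists_iso`).
-/

namespace CubicPyramid

/-! ### Vertices and the cuboid -/

section Combinatorics

variable {n m : ℕ} {i : Fin n → ℤ}

theorem step_shift (t : Fin (n + 1)) (i : Fin n → ℤ) (c : Fin (n + 1) → ℤ) :
    step t (shift i c) = shift i (c + basisVec t) := by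
  funext s
  simp only [step, shift, Pi.add_apply]
  ring

theorem shift_zero (i : Fin n → ℤ) : shift i 0 = i := by
  funext s
  simp [shift]

theorem sides_shift (m : ℕ) (i : Fin n → ℤ) (c : Fin (n + 1) → ℤ) (t : Fin (n + 1)) :
    sides m (shift i c) t = sides m i t - c t + c (t - 1) := by
  refine Fin.cases ?_ (fun s => ?_) t
  · have h1 : ∑ s : Fin n, (c s.castSucc - c s.succ) = c 0 - c (Fin.last n) := by
      have h2 := Fin.sum_univ_castSucc c
      have h3 := Fin.sum_univ_succ c
      rw [Finset.sum_sub_distrib]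
      linarith
    have h2 : (0 : Fin (n + 1)) - 1 = Fin.last n := by
      rw [sub_eq_iff_eq_add, Fin.last_add_one]
    have h3 : ∑ t, shift i c t = ∑ t, i t + ∑ s : Fin n, (c s.castSucc - c s.succ) := by
      rw [← Finset.sum_add_distrib]
      exact Finset.sum_congr rfl fun s _ => by simp only [shift]; ring
    rw [h2]
    simp only [sides, Fin.cons_zero, h3, h1]
    ring
  · have h2 : s.succ - 1 = s.castSucc := by
      rw [sub_eq_iff_eq_add, Fin.coeSucc_eq_succ]
    rw [h2]
    simp only [sides, Fin.cons_succ, shift]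
    ring

theorem sum_sides (m : ℕ) (i : Fin n → ℤ) : ∑ t, sides m i t = (m : ℤ) - 1 := by
  rw [Fin.sum_univ_succ]
  simp only [sides, Fin.cons_zero, Fin.cons_succ, Finset.sum_sub_distrib, Finset.sum_const,
    Finset.card_univ, Fintype.card_fin]
  simp
  ring

/-- The vertices are the lattice points of a simplex: `sides` gives their barycentric
coordinates. -/
theorem isVertex_iff_sides_nonneg (hn : 1 ≤ n) (i : Fin n → ℤ) :
    IsVertex m i ↔ ∀ t, 0 ≤ sides m i t := by
  constructor
  · intro h t
    refine Fin.cases ?_ (fun s => ?_) t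
    · obtain ⟨n, rfl⟩ : ∃ p, n = p + 1 := ⟨n - 1, by omega⟩
      have h1 := h.2 (Fin.last n)
      have h2 : Finset.Iic (Fin.last n) = Finset.univ := by
        ext x; simp [Fin.le_last]
      rw [h2] at h1
      simp only [sides, Fin.cons_zero]
      simp at h1 ⊢
      linarith
    · have := h.1 s
      simp only [sides, Fin.cons_succ]
      linarith
  · intro h
    have h1 : ∀ t, 1 ≤ i t := fun t => by
      have := h t.succ
      simp only [sides, Fin.cons_succ] at this
      linarith
    refine ⟨h1, fun s => ?_⟩
    have h0 := h 0
    simp only [sides, Fin.cons_zero] at h0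
    have h2 : ∑ t, i t = ∑ t ∈ Finset.Iic s, i t + ∑ t ∈ Finset.Ioi s, i t := by
      rw [← Finset.sum_filter_add_sum_filter_not Finset.univ (fun t => t ≤ s)]
      congr 1
      · exact Finset.sum_congr (by ext; simp) fun _ _ => rfl
      · exact Finset.sum_congr (by ext; simp) fun _ _ => rfl
    have h3 : ((Finset.Ioi s).card : ℤ) ≤ ∑ t ∈ Finset.Ioi s, i t := by
      have := Finset.card_nsmul_le_sum (Finset.Ioi s) i 1 fun x _ => h1 x
      simpa using this
    have h4 : ((Finset.Ioi s).card : ℤ) = n - 1 - s := by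
      rw [Fin.card_Ioi]
      have := s.2
      omega
    linarith

theorem isVertex_shift_iff (hn : 1 ≤ n) (c : Fin (n + 1) → ℤ) :
    IsVertex m (shift i c) ↔ ∀ t, c t ≤ sides m i t + c (t - 1) := by
  rw [isVertex_iff_sides_nonneg hn]
  refine forall_congr' fun t => ?_
  rw [sides_shift]
  constructor <;> intro h <;> linarith

theorem isVertex_shift_inf (hn : 1 ≤ n) {c c' : Fin (n + 1) → ℤ} (hc : IsVertex m (shift i c))
    (hc' : IsVertex m (shift i c')) : IsVertex m (shift i (c ⊓ c')) := by
  rw [isVertex_shift_iff hn] at *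
  intro t
  have h1 := hc t
  have h2 := hc' t
  simp only [Pi.inf_apply]
  omega

theorem isVertex_shift_sup (hn : 1 ≤ n) {c c' : Fin (n + 1) → ℤ} (hc : IsVertex m (shift i c))
    (hc' : IsVertex m (shift i c')) : IsVertex m (shift i (c ⊔ c')) := by
  rw [isVertex_shift_iff hn] at *
  intro t
  have h1 := hc t
  have h2 := hc' t
  simp only [Pi.sup_apply]
  omega

theorem basisVec_apply (s t : Fin (n + 1)) :
    (basisVec s : Fin (n + 1) → ℤ) t = if t = s then 1 else 0 := by
  simp [basisVec, Pi.single_apply]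

theorem sum_basisVec (s : Fin (n + 1)) : ∑ t, (basisVec s : Fin (n + 1) → ℤ) t = 1 := by
  simp [basisVec_apply]

theorem basisVec_nonneg (s : Fin (n + 1)) : (0 : Fin (n + 1) → ℤ) ≤ basisVec s := by
  intro t
  rw [basisVec_apply]
  split_ifs <;> simp

theorem isVertex_add_add (hn : 1 ≤ n) {c : Fin (n + 1) → ℤ} {s t : Fin (n + 1)} (hst : s ≠ t)
    (hs : IsVertex m (shift i (c + basisVec s))) (ht : IsVertex m (shift i (c + basisVec t))) :
    IsVertex m (shift i (c + basisVec s + basisVec t)) := by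
  convert isVertex_shift_sup hn hs ht using 2
  funext u
  simp only [Pi.add_apply, Pi.sup_apply, basisVec_apply]
  split_ifs <;> simp_all

theorem isVertex_sub_sub (hn : 1 ≤ n) {c : Fin (n + 1) → ℤ} {s t : Fin (n + 1)} (hst : s ≠ t)
    (hs : IsVertex m (shift i (c - basisVec s))) (ht : IsVertex m (shift i (c - basisVec t))) :
    IsVertex m (shift i (c - basisVec s - basisVec t)) := by
  convert isVertex_shift_inf hn hs ht using 2
  funext u
  simp only [Pi.sub_apply, Pi.inf_apply, basisVec_apply]
  split_ifs <;> simp_all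

theorem isSquare_shift (hn : 1 ≤ n) {c : Fin (n + 1) → ℤ} {s t : Fin (n + 1)} (hst : s ≠ t)
    (hc : IsVertex m (shift i c))
    (hs : IsVertex m (shift i (c + basisVec s))) (ht : IsVertex m (shift i (c + basisVec t))) :
    IsSquare m s t (shift i c) := by
  refine ⟨hc, ?_, ?_, ?_⟩ <;> simp only [step_shift]
  · exact ht
  · exact hs
  · exact isVertex_add_add hn hst.symm ht hs

/-- A nonempty set of cyclic indices that is closed under successor is everything. -/
theorem forall_of_add_one {p : Fin (n + 1) → Prop} {t₀ : Fin (n + 1)} (h₀ : p t₀)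
    (h : ∀ t, p t → p (t + 1)) (t : Fin (n + 1)) : p t := by
  have key : ∀ x : ℕ, p (t₀ + Fin.ofNat (n + 1) x) := by
    intro x
    induction x with
    | zero => simpa using h₀
    | succ x ih =>
      have h1 := h _ ih
      have h2 : Fin.ofNat (n + 1) (x + 1) = Fin.ofNat (n + 1) x + 1 := by
        ext; simp [Fin.val_add]
      rwa [h2, ← add_assoc]
  have := key ((t - t₀ : Fin (n + 1)) : ℕ)
  simpa using this

theorem add_one_ne_self (hn : 1 ≤ n) (t : Fin (n + 1)) : t + 1 ≠ t := by
  intro h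
  rw [add_eq_left] at h
  have := congrArg Fin.val h
  simp at this
  omega

theorem isVertex_sub_iff (hn : 1 ≤ n) {c : Fin (n + 1) → ℤ} {s : Fin (n + 1)}
    (hc : IsVertex m (shift i c)) :
    IsVertex m (shift i (c - basisVec s)) ↔ 1 ≤ sides m (shift i c) (s + 1) := by
  have h0 := add_one_ne_self hn s
  rw [sides_shift, isVertex_shift_iff hn]
  rw [isVertex_shift_iff hn] at hc
  constructor
  · intro h
    have := h (s + 1)
    simp [basisVec_apply, h0] at this ⊢
    linarith
  · intro h t
    have h1 := hc t
    by_cases ht : t = s + 1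
    · subst ht
      simp [basisVec_apply, h0] at h ⊢
      linarith
    · have : t - 1 ≠ s := fun h => ht (by rw [← h]; simp)
      simp only [Pi.sub_apply, basisVec_apply, this, if_false]
      split_ifs <;> linarith

end Combinatorics

/-! ### Trivializing the commutativity scalars -/

section Scalars

variable {k : Type u} [Field k] {n m : ℕ}

/-- Nonnegative points lying over a vertex. -/
def IsPoint (m : ℕ) (i : Fin n → ℤ) (c : Fin (n + 1) → ℤ) : Prop :=
  0 ≤ c ∧ IsVertex m (shift i c)

/-- The least direction in which the point `c` can be left backwards (and `0` if there is none). -/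
noncomputable def lastDir (m : ℕ) (i : Fin n → ℤ) (c : Fin (n + 1) → ℤ) : Fin (n + 1) :=
  open Classical in
  if h : {r | IsPoint m i (c - basisVec r)}.Nonempty then
    (wellFounded_lt (α := Fin (n + 1))).min _ h else 0

/-- Rescaling factors of the arrows, by recursion on the level `∑ c`: the arrow into a point that
comes from the least possible direction keeps the factor `1`, and the factors of the other arrows
into that point are forced by the commutative squares they span with this one. -/
noncomputable def lamAux (m : ℕ) (d : Coeff k n) (i : Fin n → ℤ) :
    ℕ → Fin (n + 1) → (Fin (n + 1) → ℤ) → k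
  | 0, _, _ => 1
  | K + 1, t, c =>
    let r := lastDir m i (c + basisVec t)
    if r = t then 1 else
      d t r (shift i (c - basisVec r)) * lamAux m d i K t (c - basisVec r) /
        lamAux m d i K r (c - basisVec r)

/-- The rescaling factor of the arrow of type `t` at the point `c`. -/
noncomputable def lam (m : ℕ) (d : Coeff k n) (i : Fin n → ℤ) (t : Fin (n + 1))
    (c : Fin (n + 1) → ℤ) : k :=
  lamAux m d i (∑ s, c s).toNat t c

variable {d : Coeff k n} {i : Fin n → ℤ}

theorem lastDir_spec {c : Fin (n + 1) → ℤ} {t : Fin (n + 1)} (h : IsPoint m i (c - basisVec t)) :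
    IsPoint m i (c - basisVec (lastDir m i c)) ∧ lastDir m i c ≤ t := by
  have hne : {r | IsPoint m i (c - basisVec r)}.Nonempty := ⟨t, h⟩
  rw [lastDir, dif_pos hne]
  exact ⟨(wellFounded_lt (α := Fin (n + 1))).min_mem _ hne,
    not_lt.1 ((wellFounded_lt (α := Fin (n + 1))).not_lt_min _ h)⟩

theorem IsPoint.sub_sub (hn : 1 ≤ n) {c : Fin (n + 1) → ℤ} {s t : Fin (n + 1)} (hst : s ≠ t)
    (hs : IsPoint m i (c - basisVec s)) (ht : IsPoint m i (c - basisVec t)) :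
    IsPoint m i (c - basisVec s - basisVec t) := by
  refine ⟨fun u => ?_, isVertex_sub_sub hn hst hs.2 ht.2⟩
  have h1 := hs.1 u
  have h2 := ht.1 u
  simp only [Pi.sub_apply, basisVec_apply, Pi.zero_apply] at *
  split_ifs at * <;> simp_all

theorem IsPoint.sum_nonneg {c : Fin (n + 1) → ℤ} (h : IsPoint m i c) : 0 ≤ ∑ t, c t :=
  Finset.sum_nonneg fun t _ => h.1 t

theorem sum_add_basisVec (c : Fin (n + 1) → ℤ) (t : Fin (n + 1)) :
    ∑ s, (c + basisVec t) s = ∑ s, c s + 1 := by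
  simp only [Pi.add_apply, Finset.sum_add_distrib, sum_basisVec]

theorem sum_sub_basisVec (c : Fin (n + 1) → ℤ) (t : Fin (n + 1)) :
    ∑ s, (c - basisVec t) s = ∑ s, c s - 1 := by
  simp only [Pi.sub_apply, Finset.sum_sub_distrib, sum_basisVec]

/-- The backward squares into `c + basisVec t` that determine the factor at `c`. -/
theorem lastDir_square (hn : 1 ≤ n) {c : Fin (n + 1) → ℤ} {t r : Fin (n + 1)}
    (hr : lastDir m i (c + basisVec t) = r) (hc : IsPoint m i c)
    (hrt : r ≠ t) :
    r < t ∧ IsPoint m i (c - basisVec r) ∧ IsPoint m i (c - basisVec r + basisVec t) := by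
  have h1 : IsPoint m i (c + basisVec t - basisVec t) := by simpa using hc
  obtain ⟨h2, h3⟩ := lastDir_spec h1
  rw [hr] at h2 h3
  have h4 := IsPoint.sub_sub hn hrt h2 h1
  have e1 : c + basisVec t - basisVec r - basisVec t = c - basisVec r := by abel
  have e2 : c + basisVec t - basisVec r = c - basisVec r + basisVec t := by abel
  rw [e1] at h4
  rw [e2] at h2
  exact ⟨lt_of_le_of_ne h3 hrt, h4, h2⟩

theorem lamAux_ne_zero (hn : 1 ≤ n) (hd : IsAdmissible m d) (K : ℕ) :
    ∀ (t : Fin (n + 1)) (c : Fin (n + 1) → ℤ), ∑ s, c s = K → IsPoint m i c →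
      IsPoint m i (c + basisVec t) → lamAux m d i K t c ≠ 0 := by
  induction K with
  | zero => intro t c _ _ _; simp [lamAux]
  | succ K ih =>
    intro t c hK hc hct
    simp only [lamAux]
    split_ifs with hr
    · exact one_ne_zero
    · set r := lastDir m i (c + basisVec t) with hrdef
      obtain ⟨h1, h2, h3⟩ := lastDir_square hn hrdef.symm hc hr
      have hK' : ∑ s, (c - basisVec r) s = (K : ℤ) := by
        rw [sum_sub_basisVec, hK]; push_cast; ring
      have h4 : c - basisVec r + basisVec r = c := by abel
      refine div_ne_zero (mul_ne_zero (hd.ne_zero _ _ _ h1 ?_) (ih _ _ hK' h2 h3))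
        (ih _ _ hK' h2 (by rwa [h4]))
      exact isSquare_shift hn (Ne.symm hr) h2.2 h3.2 (by rw [h4]; exact hc.2)

theorem lamAux_square_of_lastDir (hn : 1 ≤ n) (hd : IsAdmissible m d) (K : ℕ)
    {t s : Fin (n + 1)} {c : Fin (n + 1) → ℤ} (hts : t < s) (hK : ∑ u, c u = K)
    (hc : IsPoint m i c) (ht : IsPoint m i (c + basisVec t))
    (hr : lastDir m i (c + basisVec t + basisVec s) = t) :
    lamAux m d i K t c * lamAux m d i (K + 1) s (c + basisVec t) =
      d s t (shift i c) * lamAux m d i K s c * lamAux m d i (K + 1) t (c + basisVec s) := by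
  have hcomm : c + basisVec s + basisVec t = c + basisVec t + basisVec s := by abel
  have h0 : c + basisVec t - basisVec t = c := by abel
  have h1 := lamAux_ne_zero hn hd K t c hK hc ht
  simp only [lamAux, hcomm, hr, hts.ne, if_false, if_true, h0]
  field_simp

theorem lastDir_cube (hn : 1 ≤ n) {t s : Fin (n + 1)} {c : Fin (n + 1) → ℤ} (hts : t < s)
    (hc : IsPoint m i c) (ht : IsPoint m i (c + basisVec t)) (hs : IsPoint m i (c + basisVec s))
    (hr : lastDir m i (c + basisVec t + basisVec s) ≠ t) :
    lastDir m i (c + basisVec t + basisVec s) < t ∧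
      IsPoint m i (c - basisVec (lastDir m i (c + basisVec t + basisVec s))) ∧
      IsPoint m i (c - basisVec (lastDir m i (c + basisVec t + basisVec s)) + basisVec t) ∧
      IsPoint m i (c - basisVec (lastDir m i (c + basisVec t + basisVec s)) + basisVec s) := by
  set r := lastDir m i (c + basisVec t + basisVec s) with hrdef
  have hcomm : c + basisVec s + basisVec t = c + basisVec t + basisVec s := by abel
  obtain ⟨hrt, h1, -⟩ := lastDir_square hn (r := r) (by rw [hcomm]) hs hr
  obtain ⟨-, h2, -⟩ := lastDir_square hn hrdef.symm ht (hrt.trans hts).ne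
  have e1 : c + basisVec t - basisVec r = c - basisVec r + basisVec t := by abel
  have e2 : c + basisVec s - basisVec r = c - basisVec r + basisVec s := by abel
  rw [e2] at h1
  rw [e1] at h2
  refine ⟨hrt, ?_, h2, h1⟩
  have h3 : IsPoint m i (c + basisVec t - basisVec t) := by simpa using hc
  rw [← e1] at h2
  have := IsPoint.sub_sub hn hr h2 h3
  convert this using 1
  abel

/-- The factors turn every scalar of a commutative square into `1`. For the three directions
`r < t < s` into a point, the square in the directions `t, s` follows from the three squares one
level below and the admissibility condition on the cube. -/
theorem lamAux_square (hn : 1 ≤ n) (hd : IsAdmissible m d) (K : ℕ) :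
    ∀ (t s : Fin (n + 1)) (c : Fin (n + 1) → ℤ), t < s → ∑ s, c s = K → IsPoint m i c →
      IsPoint m i (c + basisVec t) → IsPoint m i (c + basisVec s) →
      lamAux m d i K t c * lamAux m d i (K + 1) s (c + basisVec t) =
        d s t (shift i c) * lamAux m d i K s c * lamAux m d i (K + 1) t (c + basisVec s) := by
  induction K with
  | zero =>
    intro t s c hts hK hc ht hs
    by_cases hr : lastDir m i (c + basisVec t + basisVec s) = t
    · exact lamAux_square_of_lastDir hn hd 0 hts hK hc ht hr
    · have hw := (lastDir_cube hn hts hc ht hs hr).2.1.sum_nonneg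
      rw [sum_sub_basisVec, hK] at hw
      norm_num at hw
  | succ K ih =>
    intro t s c hts hK hc ht hs
    by_cases hr : lastDir m i (c + basisVec t + basisVec s) = t
    · exact lamAux_square_of_lastDir hn hd _ hts hK hc ht hr
    obtain ⟨hrt, hw, hwt, hws⟩ := lastDir_cube hn hts hc ht hs hr
    obtain ⟨r, hrdef⟩ : ∃ r, r = lastDir m i (c + basisVec t + basisVec s) := ⟨_, rfl⟩
    rw [← hrdef] at hrt hw hwt hws hr
    have hrs : r < s := hrt.trans hts
    have hcomm : c + basisVec s + basisVec t = c + basisVec t + basisVec s := by abel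
    have e1 : lamAux m d i (K + 1 + 1) s (c + basisVec t) =
        d s r (shift i (c + basisVec t - basisVec r)) *
          lamAux m d i (K + 1) s (c + basisVec t - basisVec r) /
            lamAux m d i (K + 1) r (c + basisVec t - basisVec r) := by
      rw [lamAux]
      simp only [← hrdef, hrs.ne, if_false]
    have e2 : lamAux m d i (K + 1 + 1) t (c + basisVec s) =
        d t r (shift i (c + basisVec s - basisVec r)) *
          lamAux m d i (K + 1) t (c + basisVec s - basisVec r) /
            lamAux m d i (K + 1) r (c + basisVec s - basisVec r) := by
      rw [lamAux, hcomm]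
      simp only [← hrdef, hrt.ne, if_false]
    -- everything is expressed from the lowest vertex `w` of the cube
    obtain ⟨w, rfl⟩ : ∃ w, c = w + basisVec r := ⟨c - basisVec r, by abel⟩
    have f1 : w + basisVec r - basisVec r = w := by abel
    have f2 : w + basisVec r + basisVec t - basisVec r = w + basisVec t := by abel
    have f3 : w + basisVec r + basisVec s - basisVec r = w + basisVec s := by abel
    rw [f2] at e1
    rw [f3] at e2
    rw [f1] at hw hwt hws
    rw [sum_add_basisVec] at hK
    have hKw : ∑ u, w u = (K : ℤ) := by push_cast at hK; linarith
    have s1 := ih r t w hrt hKw hw hc hwt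
    have s2 := ih r s w hrs hKw hw hc hws
    have s3 := ih t s w hts hKw hw hwt hws
    have n1 := lamAux_ne_zero hn hd K r w hKw hw hc
    have n2 := lamAux_ne_zero hn hd K t w hKw hw hwt
    have g1 : IsPoint m i (w + basisVec t + basisVec r) := by
      convert ht using 1; abel
    have g2 : IsPoint m i (w + basisVec s + basisVec r) := by
      convert hs using 1; abel
    have n3 := lamAux_ne_zero hn hd (K + 1) r (w + basisVec t)
      (by rw [sum_add_basisVec, hKw]; push_cast; ring) hwt g1
    have n4 := lamAux_ne_zero hn hd (K + 1) r (w + basisVec s)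
      (by rw [sum_add_basisVec, hKw]; push_cast; ring) hws g2
    have g3 : IsVertex m (shift i (w + basisVec t + basisVec s)) :=
      isVertex_add_add hn hts.ne hwt.2 hws.2
    have g4 : IsVertex m (shift i (w + basisVec s + basisVec t)) :=
      isVertex_add_add hn hts.ne' hws.2 hwt.2
    have cube := hd.multiplicative r t s (shift i w) hrt hts
      (isSquare_shift hn hrt.ne' hw.2 hwt.2 hc.2) (isSquare_shift hn hrs.ne' hw.2 hws.2 hc.2)
      (isSquare_shift hn hts.ne' hw.2 hws.2 hwt.2)
      (by rw [step_shift]; exact isSquare_shift hn hrt.ne' hws.2 g4 g2.2)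
      (by rw [step_shift]; exact isSquare_shift hn hrs.ne' hwt.2 g3 g1.2)
      (by rw [step_shift]; exact isSquare_shift hn hts.ne' hc.2 hs.2 ht.2)
    simp only [step_shift] at cube
    rw [e1, e2]
    set A := lamAux m d i K r w
    set B := lamAux m d i K t w
    set C := lamAux m d i K s w
    set X := lamAux m d i (K + 1) t (w + basisVec r)
    set Y := lamAux m d i (K + 1) s (w + basisVec r)
    set Z := lamAux m d i (K + 1) s (w + basisVec t)
    set U := lamAux m d i (K + 1) r (w + basisVec t)
    set W := lamAux m d i (K + 1) t (w + basisVec s)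
    set T := lamAux m d i (K + 1) r (w + basisVec s)
    rw [mul_div_assoc', mul_div_assoc', div_eq_div_iff n3 n4]
    apply mul_left_cancel₀ (mul_ne_zero n1 n2)
    linear_combination (B * d s r (shift i (w + basisVec t)) * Z * T) * s1 +
      (B * d t r (shift i w) * U * T * d s r (shift i (w + basisVec t))) * s3 -
      (B * d s t (shift i (w + basisVec r)) * W * U * d t r (shift i (w + basisVec s))) * s2 +
      (B * C * T * W * U) * cube

/-- The rescaling factors are nonzero. -/
theorem lam_ne_zero (hn : 1 ≤ n) (hd : IsAdmissible m d) {t : Fin (n + 1)}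
    {c : Fin (n + 1) → ℤ} (hc : IsPoint m i c) (hct : IsPoint m i (c + basisVec t)) :
    lam m d i t c ≠ 0 :=
  lamAux_ne_zero hn hd _ t c (Int.toNat_of_nonneg hc.sum_nonneg).symm hc hct

theorem lam_square (hn : 1 ≤ n) (hd : IsAdmissible m d) {t s : Fin (n + 1)}
    {c : Fin (n + 1) → ℤ} (hts : t < s) (hc : IsPoint m i c) (ht : IsPoint m i (c + basisVec t))
    (hs : IsPoint m i (c + basisVec s)) :
    lam m d i t c * lam m d i s (c + basisVec t) =
      d s t (shift i c) * lam m d i s c * lam m d i t (c + basisVec s) := by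
  have h := lamAux_square hn hd (∑ s, c s).toNat t s c hts
    (Int.toNat_of_nonneg hc.sum_nonneg).symm hc ht hs
  have h1 : ∀ r : Fin (n + 1), (∑ u, (c + basisVec r) u).toNat = (∑ u, c u).toNat + 1 := fun r => by
    have := hc.sum_nonneg
    rw [sum_add_basisVec]
    omega
  simpa only [lam, h1] using h

end Scalars

/-! ### Relations in the stable pyramid algebra -/

section Relations

variable {k : Type u} [Field k] {n m : ℕ} {d : Coeff k n}

/-- The quotient map onto the stable pyramid algebra. -/
noncomputable def quotMap (m : ℕ) (d : Coeff k n) :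
    FreeAlgebra k (Vertex n m ⊕ Arrow n m) →ₐ[k] StableAlg m d :=
  RingQuot.mkAlgHom k (Rel m d)

theorem quotMap_surjective : Function.Surjective (quotMap m d) :=
  RingQuot.mkAlgHom_surjective k (Rel m d)

theorem quotMap_rel {x y : FreeAlgebra k (Vertex n m ⊕ Arrow n m)} (h : Rel m d x y) :
    quotMap m d x = quotMap m d y :=
  RingQuot.mkAlgHom_rel k h

theorem quotMap_freeIdem (j : Fin n → ℤ) : quotMap m d (freeIdem k m j) = idem m d j := rfl

theorem quotMap_freeArrow (t : Fin (n + 1)) (j : Fin n → ℤ) :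
    quotMap m d (freeArrow k m t j) = arrow m d t j := rfl

theorem idem_eq_zero {j : Fin n → ℤ} (h : ¬ IsVertex m j) : idem m d j = 0 := by
  rw [← quotMap_freeIdem, freeIdem, dif_neg h, map_zero]

theorem arrow_eq_zero {t : Fin (n + 1)} {j : Fin n → ℤ}
    (h : ¬ (IsVertex m j ∧ IsVertex m (step t j))) : arrow m d t j = 0 := by
  rw [← quotMap_freeArrow, freeArrow, dif_neg h, map_zero]

theorem idem_mul_idem_self (j : Fin n → ℤ) : idem m d j * idem m d j = idem m d j := by
  by_cases h : IsVertex m j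
  · have := quotMap_rel (Rel.idem_mul_self (d := d) ⟨j, h⟩)
    rwa [map_mul] at this
  · simp [idem_eq_zero h]

theorem idem_mul_idem_of_ne {j j' : Fin n → ℤ} (hj : j ≠ j') :
    idem m d j * idem m d j' = 0 := by
  by_cases h : IsVertex m j
  · by_cases h' : IsVertex m j'
    · have := quotMap_rel
        (Rel.idem_mul_idem (d := d) ⟨j, h⟩ ⟨j', h'⟩ (by simpa using hj))
      rwa [map_mul, map_zero] at this
    · simp [idem_eq_zero h']
  · simp [idem_eq_zero h]

theorem arrow_mul_idem_self (t : Fin (n + 1)) (j : Fin n → ℤ) :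
    arrow m d t j * idem m d j = arrow m d t j := by
  by_cases h : IsVertex m j ∧ IsVertex m (step t j)
  · have := quotMap_rel (Rel.arrow_mul_source (d := d) ⟨(t, j), h⟩)
    rwa [map_mul] at this
  · simp [arrow_eq_zero h]

theorem idem_mul_arrow_self (t : Fin (n + 1)) (j : Fin n → ℤ) :
    idem m d (step t j) * arrow m d t j = arrow m d t j := by
  by_cases h : IsVertex m j ∧ IsVertex m (step t j)
  · have := quotMap_rel (Rel.target_mul_arrow (d := d) ⟨(t, j), h⟩)
    rwa [map_mul] at this
  · simp [arrow_eq_zero h]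

theorem arrow_mul_idem_of_ne (t : Fin (n + 1)) {j j' : Fin n → ℤ} (h : j ≠ j') :
    arrow m d t j * idem m d j' = 0 := by
  rw [← arrow_mul_idem_self, mul_assoc, idem_mul_idem_of_ne h, mul_zero]

theorem idem_mul_arrow_of_ne (t : Fin (n + 1)) {j j' : Fin n → ℤ} (h : j' ≠ step t j) :
    idem m d j' * arrow m d t j = 0 := by
  rw [← idem_mul_arrow_self, ← mul_assoc, idem_mul_idem_of_ne h, zero_mul]

theorem arrow_mul_arrow_same (t : Fin (n + 1)) (j : Fin n → ℤ) :
    arrow m d t (step t j) * arrow m d t j = 0 := by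
  by_cases h : IsVertex m j ∧ IsVertex m (step t j)
  · by_cases h' : IsVertex m (step t (step t j))
    · have := quotMap_rel (Rel.same_type (d := d) t j h.1 h.2 h')
      rwa [map_mul, map_zero] at this
    · rw [arrow_eq_zero (fun h'' => h' h''.2), zero_mul]
  · rw [arrow_eq_zero h, mul_zero]

theorem arrow_square {s t : Fin (n + 1)} {j : Fin n → ℤ} (hts : t < s) (h : IsSquare m s t j) :
    d s t j • (arrow m d t (step s j) * arrow m d s j) =
      arrow m d s (step t j) * arrow m d t j := by
  have := quotMap_rel (Rel.square (d := d) s t j hts h)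
  rwa [map_smul, map_mul, map_mul] at this

/-- A subspace that is stable under left multiplication by idempotents and arrows is a left
ideal. -/
theorem mul_mem_of_stable (W : Submodule k (StableAlg m d))
    (hidem : ∀ j, ∀ x ∈ W, idem m d j * x ∈ W)
    (harrow : ∀ t j, ∀ x ∈ W, arrow m d t j * x ∈ W) (y : StableAlg m d) :
    ∀ x ∈ W, y * x ∈ W := by
  obtain ⟨z, rfl⟩ := quotMap_surjective y
  induction z with
  | grade0 r =>
    intro x hx
    rw [AlgHom.commutes, ← Algebra.smul_def]
    exact W.smul_mem r hx
  | grade1 v =>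
    intro x hx
    rcases v with v | p
    · have := hidem v.1 x hx
      rwa [← quotMap_freeIdem, freeIdem, dif_pos v.2] at this
    · have := harrow p.1.1 p.1.2 x hx
      rwa [← quotMap_freeArrow, freeArrow, dif_pos p.2] at this
  | mul a b ha hb =>
    intro x hx
    rw [map_mul, mul_assoc]
    exact ha _ (hb _ hx)
  | add a b ha hb =>
    intro x hx
    rw [map_add, add_mul]
    exact W.add_mem (ha _ hx) (hb _ hx)

end Relations

/-! ### The cube of paths starting at a point -/

section Cube

variable {n m : ℕ} {i : Fin n → ℤ}

/-- The points `c` of the unit cube at `a` that lie over a vertex; they index the paths of pairwise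
different arrow types that start at `a`. -/
def InCube (m : ℕ) (i : Fin n → ℤ) (a c : Fin (n + 1) → ℤ) : Prop :=
  a ≤ c ∧ c ≤ a + 1 ∧ IsVertex m (shift i c)

theorem InCube.isPoint {a c : Fin (n + 1) → ℤ} (hc : InCube m i a c) (ha : 0 ≤ a) :
    IsPoint m i c := ⟨ha.trans hc.1, hc.2.2⟩

theorem inCube_self {a : Fin (n + 1) → ℤ} (ha : IsVertex m (shift i a)) : InCube m i a a :=
  ⟨le_rfl, fun t => by simp, ha⟩

theorem inCube_iff {a c : Fin (n + 1) → ℤ} (ha : a ≤ c) (hc : IsVertex m (shift i c)) :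
    InCube m i a c ↔ ∀ t, c t ≤ a t + 1 :=
  ⟨fun h t => by simpa using h.2.1 t, fun h => ⟨ha, fun t => by simpa using h t, hc⟩⟩

theorem InCube.sub {a c : Fin (n + 1) → ℤ} {s : Fin (n + 1)} (hc : InCube m i a c)
    (hs : c s = a s + 1) (hv : IsVertex m (shift i (c - basisVec s))) :
    InCube m i a (c - basisVec s) := by
  refine ⟨fun t => ?_, fun t => ?_, hv⟩
  · have := hc.1 t
    simp only [Pi.sub_apply, basisVec_apply]
    split_ifs with h
    · subst h; omega
    · simpa using this
  · have := hc.2.1 t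
    have h2 := basisVec_nonneg s t
    simp only [Pi.sub_apply, Pi.zero_apply] at *
    linarith

/-- If a path from `a` to `c` uses the direction `s` and cannot end with it, because the barycentric
coordinate `s + 1` of `c` vanishes, then it also uses the direction `s + 1`. -/
theorem InCube.add_one_of_sides_eq_zero {a c : Fin (n + 1) → ℤ} {s : Fin (n + 1)}
    (hn : 1 ≤ n) (ha : IsVertex m (shift i a)) (hc : InCube m i a c) (hs : c s = a s + 1)
    (h : sides m (shift i c) (s + 1) ≤ 0) : c (s + 1) = a (s + 1) + 1 := by
  have h1 := (isVertex_iff_sides_nonneg hn _).1 ha (s + 1)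
  rw [sides_shift, add_sub_cancel_right] at h h1
  have h2 := hc.2.1 (s + 1)
  simp only [Pi.add_apply, Pi.one_apply] at h2
  omega

theorem InCube.exists_eq_add_one {a c : Fin (n + 1) → ℤ} (hc : InCube m i a c) (hne : c ≠ a) :
    ∃ s, c s = a s + 1 := by
  by_contra! h
  refine hne (funext fun t => ?_)
  have h1 : a t ≤ c t := hc.1 t
  have h2 := hc.2.1 t
  have h3 : c t ≠ a t + 1 := h t
  simp only [Pi.add_apply, Pi.one_apply] at h2
  omega

/-- Every path of positive length ends with some arrow: not all barycentric coordinates of a vertex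
vanish. -/
theorem InCube.exists_sub (hn : 1 ≤ n) (hm : 3 ≤ m) {a c : Fin (n + 1) → ℤ}
    (ha : IsVertex m (shift i a)) (hc : InCube m i a c) (hne : c ≠ a) :
    ∃ s, InCube m i a (c - basisVec s) := by
  by_contra! h
  have h0 : ∀ s, c s = a s + 1 → sides m (shift i c) (s + 1) ≤ 0 := by
    intro s hs
    by_contra! h1
    exact h s (hc.sub hs ((isVertex_sub_iff hn hc.2.2).2 h1))
  obtain ⟨s₀, hs₀⟩ := hc.exists_eq_add_one hne
  have hall : ∀ s, c s = a s + 1 := forall_of_add_one hs₀ fun s hs =>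
    hc.add_one_of_sides_eq_zero hn ha hs (h0 s hs)
  have h2 : ∑ t, sides m (shift i c) t ≤ 0 := Finset.sum_nonpos fun t _ => by
    simpa using h0 (t - 1) (hall _)
  rw [sum_sides] at h2
  omega

/-- A path that contains an arrow of type `t` and can be prolonged by an arrow of type `t` can be
reordered such that its last arrow either has type `t` or commutes with the new arrow of type `t`.
This uses that the barycentric coordinates of a vertex sum up to `m - 1 ≥ 2`. -/
theorem InCube.exists_sub_of_add (hn : 1 ≤ n) (hm : 3 ≤ m) {a c : Fin (n + 1) → ℤ}
    {t : Fin (n + 1)} (ha : IsVertex m (shift i a)) (hc : InCube m i a c) (ht : c t = a t + 1)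
    (hct : IsVertex m (shift i (c + basisVec t))) :
    ∃ s, InCube m i a (c - basisVec s) ∧
      (s = t ∨ s ≠ t ∧ IsVertex m (shift i (c - basisVec s + basisVec t))) := by
  by_contra! h
  have hB : ∀ u, sides m (shift i (c + basisVec t)) u =
      sides m (shift i c) u - (if u = t then 1 else 0) + (if u - 1 = t then 1 else 0) := by
    intro u
    simp only [sides_shift, Pi.add_apply, basisVec_apply]
    ring
  -- in each direction of `c` other than `t`, going back is obstructed
  have h0 : ∀ s, s ≠ t → c s = a s + 1 → sides m (shift i (c + basisVec t)) (s + 1) ≤ 0 := by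
    intro s hst hs
    by_contra! h1
    have h2 := (isVertex_sub_iff (s := s) hn hct).2 h1
    have e : c + basisVec t - basisVec s = c - basisVec s + basisVec t := by abel
    have h3 : IsVertex m (shift i (c - basisVec s)) := by
      have h4 : IsVertex m (shift i (c + basisVec t - basisVec t)) := by simpa using hc.2.2
      have := isVertex_sub_sub hn hst h2 h4
      rwa [e, add_sub_cancel_right] at this
    exact (h s (hc.sub hs h3)).2 hst (by rwa [← e])
  have h1 : ∀ s, c s = a s + 1 → s + 1 ≠ t → sides m (shift i c) (s + 1) ≤ 0 := by
    intro s hs hst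
    by_cases hs' : s = t
    · subst hs'
      by_contra! h1
      exact (h s (hc.sub hs ((isVertex_sub_iff hn hc.2.2).2 h1))).1 rfl
    · have := h0 s hs' hs
      rw [hB, if_neg hst, add_sub_cancel_right, if_neg hs'] at this
      linarith
  have hall : ∀ s, c s = a s + 1 := forall_of_add_one ht fun s hs => by
    by_cases hst : s + 1 = t
    · rw [hst, ht]
    · exact hc.add_one_of_sides_eq_zero hn ha hs (h1 s hs hst)
  have h2 : sides m (shift i c) t ≤ 1 := by
    have h3 : t - 1 ≠ t := fun h => add_one_ne_self hn t (sub_eq_iff_eq_add.1 h).symm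
    have h4 := h0 (t - 1) h3 (hall _)
    rw [hB, sub_add_cancel, if_pos rfl, if_neg h3] at h4
    linarith
  have h5 : ∑ u, sides m (shift i c) u ≤ ∑ u, if u = t then 1 else 0 := by
    refine Finset.sum_le_sum fun u _ => ?_
    split_ifs with hu
    · rwa [hu]
    · simpa using h1 (u - 1) (hall _) (by simpa using hu)
  rw [sum_sides] at h5
  simp at h5
  omega

end Cube

/-! ### Path elements -/

section Paths

variable {k : Type u} [Field k] {n m : ℕ} {d : Coeff k n} {i : Fin n → ℤ}

/-- The rescaled arrow of type `t` at the point `c`. Rescaled arrows commute strictly. -/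
noncomputable def scaledArrow (m : ℕ) (d : Coeff k n) (i : Fin n → ℤ) (t : Fin (n + 1))
    (c : Fin (n + 1) → ℤ) : StableAlg m d :=
  (lam m d i t c)⁻¹ • arrow m d t (shift i c)

theorem scaledArrow_eq_zero {t : Fin (n + 1)} {c : Fin (n + 1) → ℤ}
    (h : ¬ IsVertex m (shift i (c + basisVec t))) : scaledArrow m d i t c = 0 := by
  rw [scaledArrow, arrow_eq_zero, smul_zero]
  rw [step_shift]
  exact fun h' => h h'.2

theorem scaledArrow_mul_same (t : Fin (n + 1)) (c : Fin (n + 1) → ℤ) :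
    scaledArrow m d i t (c + basisVec t) * scaledArrow m d i t c = 0 := by
  rw [scaledArrow, scaledArrow, smul_mul_smul_comm, ← step_shift, arrow_mul_arrow_same, smul_zero]

theorem arrow_eq_smul_scaledArrow (hn : 1 ≤ n) (hd : IsAdmissible m d) {t : Fin (n + 1)}
    {c : Fin (n + 1) → ℤ} (hc : 0 ≤ c) :
    arrow m d t (shift i c) = lam m d i t c • scaledArrow m d i t c := by
  by_cases h : IsVertex m (shift i c) ∧ IsVertex m (step t (shift i c))
  · rw [step_shift] at h
    rw [scaledArrow, smul_inv_smul₀]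
    exact lam_ne_zero hn hd ⟨hc, h.1⟩ ⟨hc.trans (le_add_of_nonneg_right (basisVec_nonneg t)), h.2⟩
  · rw [scaledArrow, arrow_eq_zero h, smul_zero, smul_zero]

theorem scaledArrow_comm_of_lt (hn : 1 ≤ n) (hd : IsAdmissible m d) {s t : Fin (n + 1)}
    {c : Fin (n + 1) → ℤ} (hts : t < s) (hc : IsPoint m i c) (hs : IsPoint m i (c + basisVec s))
    (ht : IsPoint m i (c + basisVec t)) :
    scaledArrow m d i s (c + basisVec t) * scaledArrow m d i t c =
      scaledArrow m d i t (c + basisVec s) * scaledArrow m d i s c := by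
  have h1 : IsPoint m i (c + basisVec t + basisVec s) :=
    ⟨ht.1.trans (le_add_of_nonneg_right (basisVec_nonneg s)),
      isVertex_add_add hn hts.ne ht.2 hs.2⟩
  have h2 : IsPoint m i (c + basisVec s + basisVec t) := by
    convert h1 using 1; abel
  have n1 := lam_ne_zero hn hd hc ht
  have n2 := lam_ne_zero hn hd hc hs
  have n3 := lam_ne_zero hn hd ht h1
  have n4 := lam_ne_zero hn hd hs h2
  have key := lam_square hn hd hts hc ht hs
  simp only [scaledArrow]
  rw [smul_mul_smul_comm, smul_mul_smul_comm, ← step_shift, ← step_shift, ← arrow_square hts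
    (isSquare_shift hn hts.ne' hc.2 hs.2 ht.2), smul_smul]
  congr 1
  field_simp
  linear_combination -key

theorem scaledArrow_comm (hn : 1 ≤ n) (hd : IsAdmissible m d) {s t : Fin (n + 1)}
    {c : Fin (n + 1) → ℤ} (hts : t ≠ s) (hc : IsPoint m i c) (hs : IsPoint m i (c + basisVec s))
    (ht : IsPoint m i (c + basisVec t)) :
    scaledArrow m d i s (c + basisVec t) * scaledArrow m d i t c =
      scaledArrow m d i t (c + basisVec s) * scaledArrow m d i s c := by
  rcases lt_or_gt_of_ne hts with h | h
  · exact scaledArrow_comm_of_lt hn hd h hc hs ht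
  · exact (scaledArrow_comm_of_lt hn hd h hc ht hs).symm

/-- A product of `K` rescaled arrows of different types along a path from `a` to `c`. The path is
chosen by going back from `c` inside the cube at `a`. For points `c` of the cube with
`∑ c = ∑ a + K` this is always possible (`InCube.exists_sub`); other values are not used. -/
noncomputable def pathAux (m : ℕ) (d : Coeff k n) (i : Fin n → ℤ) (a : Fin (n + 1) → ℤ) :
    ℕ → (Fin (n + 1) → ℤ) → StableAlg m d
  | 0, _ => idem m d (shift i a)
  | K + 1, c =>
    open Classical in
    if h : ∃ s, InCube m i a (c - basisVec s) then
      scaledArrow m d i h.choose (c - basisVec h.choose) *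
        pathAux m d i a K (c - basisVec h.choose)
    else 0

theorem pathAux_succ {a c : Fin (n + 1) → ℤ} (K : ℕ)
    (h : ∃ s, InCube m i a (c - basisVec s)) :
    pathAux m d i a (K + 1) c = scaledArrow m d i h.choose (c - basisVec h.choose) *
        pathAux m d i a K (c - basisVec h.choose) :=
  dif_pos h

/-- The path element from `a` to `c`; it is `0` if `c` does not belong to the cube at `a`. -/
noncomputable def path (m : ℕ) (d : Coeff k n) (i : Fin n → ℤ) (a c : Fin (n + 1) → ℤ) :
    StableAlg m d :=
  open Classical in
  if InCube m i a c then pathAux m d i a (∑ t, c t - ∑ t, a t).toNat c else 0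

/-- Multiplying a path element by an arrow gives the path element of the longer path, whatever
order of the arrows was chosen, or zero if an arrow type is repeated. -/
theorem scaledArrow_mul_pathAux (hn : 1 ≤ n) (hm : 3 ≤ m) (hd : IsAdmissible m d)
    {a : Fin (n + 1) → ℤ} (ha : IsPoint m i a) (K : ℕ) :
    ∀ (c : Fin (n + 1) → ℤ) (t : Fin (n + 1)), InCube m i a c → ∑ s, c s = ∑ s, a s + K →
      (InCube m i a (c + basisVec t) →
        scaledArrow m d i t c * pathAux m d i a K c = pathAux m d i a (K + 1) (c + basisVec t)) ∧
      (¬ InCube m i a (c + basisVec t) → scaledArrow m d i t c * pathAux m d i a K c = 0) := by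
  induction K with
  | zero =>
    intro c t hc hK
    have hca : c = a := by
      have h1 : ∑ s, (c s - a s) = 0 := by
        rw [Finset.sum_sub_distrib, hK]; simp
      have h2 := (Finset.sum_eq_zero_iff_of_nonneg
        (fun s _ => sub_nonneg.2 (hc.1 s))).1 h1
      exact funext fun s => by have := h2 s (Finset.mem_univ _); linarith
    subst hca
    constructor
    · intro hct
      have h : ∃ s, InCube m i c (c + basisVec t - basisVec s) :=
        ⟨t, by rwa [add_sub_cancel_right]⟩
      have h1 : h.choose = t := by
        by_contra hne
        have := h.choose_spec.1 h.choose
        simp [basisVec_apply, hne] at this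
      rw [pathAux_succ 0 h, h1, add_sub_cancel_right]
    · intro hct
      rw [scaledArrow_eq_zero, zero_mul]
      intro hv
      refine hct ((inCube_iff (le_add_of_nonneg_right (basisVec_nonneg t)) hv).2 fun s => ?_)
      simp only [Pi.add_apply, basisVec_apply]
      split_ifs <;> simp
  | succ K ih =>
    -- a path of positive length can be split off at any admissible last arrow
    have split : ∀ (z : Fin (n + 1) → ℤ) (s : Fin (n + 1)), InCube m i a z →
        InCube m i a (z + basisVec s) → ∑ u, (z + basisVec s) u = ∑ u, a u + (K + 1 : ℕ) →
        ∑ u, z u = ∑ u, a u + K ∧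
        pathAux m d i a (K + 1) (z + basisVec s) =
          scaledArrow m d i s z * pathAux m d i a K z := by
      intro z s hz hzs hK
      have hK' : ∑ u, z u = ∑ u, a u + K := by
        rw [sum_add_basisVec] at hK; push_cast at hK; linarith
      exact ⟨hK', ((ih z s hz hK').1 hzs).symm⟩
    intro c t hc hK
    constructor
    · intro hct
      have h : ∃ s, InCube m i a (c + basisVec t - basisVec s) :=
        ⟨t, by rwa [add_sub_cancel_right]⟩
      have hs := h.choose_spec
      rw [pathAux_succ (K + 1) h]
      generalize h.choose = s at hs ⊢
      by_cases hst : s = t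
      · rw [hst, add_sub_cancel_right]
      obtain ⟨z, rfl⟩ : ∃ z, c = z + basisVec s := ⟨c - basisVec s, by abel⟩
      have e : z + basisVec s + basisVec t - basisVec s = z + basisVec t := by abel
      rw [e] at hs ⊢
      have hz : InCube m i a z := by
        have h1 : IsVertex m (shift i (z + basisVec s + basisVec t - basisVec t)) := by
          rw [add_sub_cancel_right]; exact hc.2.2
        have h2 : IsVertex m (shift i (z + basisVec s + basisVec t - basisVec s)) := by
          rw [e]; exact hs.2.2
        have h3 := isVertex_sub_sub hn hst h2 h1
        rw [e, add_sub_cancel_right] at h3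
        refine (inCube_iff (fun u => ?_) h3).2 fun u => ?_
        · have h4 := hc.1 u
          have h5 := hs.1 u
          simp only [Pi.add_apply, basisVec_apply] at h4 h5
          split_ifs at h4 h5 with h6 h7
          · exact absurd (h6.symm.trans h7) hst
          all_goals simp_all
        · have h4 := hc.2.1 u
          have h5 := basisVec_nonneg s u
          simp only [Pi.add_apply, Pi.one_apply, Pi.zero_apply] at h4 h5
          linarith
      obtain ⟨hK', h1⟩ := split z s hz hc hK
      rw [h1, ← mul_assoc, scaledArrow_comm hn hd hst (hz.isPoint ha.1) (hs.isPoint ha.1)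
        (hc.isPoint ha.1), mul_assoc, (ih z t hz hK').1 hs]
    · intro hct
      by_cases hv : IsVertex m (shift i (c + basisVec t))
      swap
      · rw [scaledArrow_eq_zero hv, zero_mul]
      have ht : c t = a t + 1 := by
        by_contra hne
        refine hct ((inCube_iff (hc.1.trans (le_add_of_nonneg_right (basisVec_nonneg t))) hv).2
          fun u => ?_)
        have h1 := hc.2.1 u
        simp only [Pi.add_apply, Pi.one_apply, basisVec_apply] at h1 ⊢
        split_ifs with h
        · subst h; omega
        · linarith
      obtain ⟨s, hs, hst⟩ := hc.exists_sub_of_add hn hm ha.2 ht hv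
      obtain ⟨z, rfl⟩ : ∃ z, c = z + basisVec s := ⟨c - basisVec s, by abel⟩
      rw [add_sub_cancel_right] at hs hst
      obtain ⟨hK', h1⟩ := split z s hs hc hK
      rw [h1, ← mul_assoc]
      rcases hst with rfl | ⟨hst, hzt⟩
      · rw [scaledArrow_mul_same, zero_mul]
      · have hzt' : IsPoint m i (z + basisVec t) :=
          ⟨(hs.isPoint ha.1).1.trans (le_add_of_nonneg_right (basisVec_nonneg t)), hzt⟩
        rw [scaledArrow_comm hn hd hst (hs.isPoint ha.1) hzt' (hc.isPoint ha.1), mul_assoc,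
          (ih z t hs hK').2, mul_zero]
        intro h2
        have := h2.2.1 t
        simp [basisVec_apply, hst.symm] at this ht
        omega

theorem path_eq_zero {a c : Fin (n + 1) → ℤ} (h : ¬ InCube m i a c) : path m d i a c = 0 :=
  if_neg h

theorem path_self {a : Fin (n + 1) → ℤ} (ha : IsVertex m (shift i a)) :
    path m d i a a = idem m d (shift i a) := by
  simp [path, inCube_self ha, pathAux]

theorem scaledArrow_mul_path (hn : 1 ≤ n) (hm : 3 ≤ m) (hd : IsAdmissible m d)
    {a c : Fin (n + 1) → ℤ} (ha : IsPoint m i a) (hc : InCube m i a c) (t : Fin (n + 1)) :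
    scaledArrow m d i t c * path m d i a c = path m d i a (c + basisVec t) := by
  have h0 : 0 ≤ ∑ s, c s - ∑ s, a s :=
    sub_nonneg.2 (Finset.sum_le_sum fun s _ => hc.1 s)
  have h1 : ∑ s, c s = ∑ s, a s + ((∑ s, c s - ∑ s, a s).toNat : ℤ) := by
    rw [Int.toNat_of_nonneg h0]; ring
  have h2 : (∑ s, (c + basisVec t) s - ∑ s, a s).toNat = (∑ s, c s - ∑ s, a s).toNat + 1 := by
    rw [sum_add_basisVec]; omega
  have h3 := scaledArrow_mul_pathAux hn hm hd ha _ c t hc h1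
  rw [path, if_pos hc]
  by_cases h : InCube m i a (c + basisVec t)
  · rw [h3.1 h, path, if_pos h, h2]
  · rw [h3.2 h, path, if_neg h]

theorem arrow_mul_path (hn : 1 ≤ n) (hm : 3 ≤ m) (hd : IsAdmissible m d)
    {a c : Fin (n + 1) → ℤ} (ha : IsPoint m i a) (hc : InCube m i a c) (t : Fin (n + 1)) :
    arrow m d t (shift i c) * path m d i a c =
      lam m d i t c • path m d i a (c + basisVec t) := by
  rw [arrow_eq_smul_scaledArrow hn hd (hc.isPoint ha.1).1, smul_mul_assoc,
    scaledArrow_mul_path hn hm hd ha hc]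

/-- Induction along the cube at `a`. -/
theorem InCube.induction (hn : 1 ≤ n) (hm : 3 ≤ m) {a : Fin (n + 1) → ℤ}
    (ha : IsVertex m (shift i a)) {P : (Fin (n + 1) → ℤ) → Prop} (base : P a)
    (ind : ∀ c t, InCube m i a c → InCube m i a (c + basisVec t) → P c → P (c + basisVec t))
    {c : Fin (n + 1) → ℤ} (hc : InCube m i a c) : P c := by
  obtain ⟨K, hK⟩ : ∃ K : ℕ, ∑ s, c s = ∑ s, a s + K := by
    have h0 : 0 ≤ ∑ s, c s - ∑ s, a s :=
      sub_nonneg.2 (Finset.sum_le_sum fun s _ => hc.1 s)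
    exact ⟨(∑ s, c s - ∑ s, a s).toNat, by rw [Int.toNat_of_nonneg h0]; ring⟩
  induction K generalizing c with
  | zero =>
    by_cases hca : c = a
    · rwa [hca]
    · obtain ⟨s, hs⟩ := hc.exists_sub hn hm ha hca
      have h1 := Finset.sum_le_sum fun u (_ : u ∈ Finset.univ) => hs.1 u
      rw [sum_sub_basisVec, hK] at h1
      norm_num at h1
  | succ K ih =>
    by_cases hca : c = a
    · rwa [hca]
    · obtain ⟨s, hs⟩ := hc.exists_sub hn hm ha hca
      have h1 := ih hs (by rw [sum_sub_basisVec, hK]; push_cast; ring)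
      have h2 := ind _ s hs (by rwa [sub_add_cancel]) h1
      rwa [sub_add_cancel] at h2

theorem idem_mul_path (hn : 1 ≤ n) (hm : 3 ≤ m) (hd : IsAdmissible m d)
    {a c : Fin (n + 1) → ℤ} (ha : IsPoint m i a) (hc : InCube m i a c) :
    idem m d (shift i c) * path m d i a c = path m d i a c := by
  refine InCube.induction hn hm ha.2 (P := fun c => idem m d (shift i c) * path m d i a c =
    path m d i a c) ?_ ?_ hc
  · rw [path_self ha.2, idem_mul_idem_self]
  · intro c t hc hct _
    rw [← scaledArrow_mul_path hn hm hd ha hc, scaledArrow, smul_mul_assoc, mul_smul_comm,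
      ← mul_assoc, ← step_shift, idem_mul_arrow_self]

theorem path_mul_idem (hn : 1 ≤ n) (hm : 3 ≤ m) (hd : IsAdmissible m d)
    {a c : Fin (n + 1) → ℤ} (ha : IsPoint m i a) (hc : InCube m i a c) :
    path m d i a c * idem m d (shift i a) = path m d i a c := by
  refine InCube.induction hn hm ha.2 (P := fun c => path m d i a c * idem m d (shift i a) =
    path m d i a c) ?_ ?_ hc
  · rw [path_self ha.2, idem_mul_idem_self]
  · intro c t hc hct h
    rw [← scaledArrow_mul_path hn hm hd ha hc, mul_assoc, h]

theorem path_mem_proj (hn : 1 ≤ n) (hm : 3 ≤ m) (hd : IsAdmissible m d)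
    {a : Fin (n + 1) → ℤ} (ha : IsPoint m i a) (c : Fin (n + 1) → ℤ) :
    path m d i a c ∈ Proj m d (shift i a) := by
  by_cases hc : InCube m i a c
  · rw [← path_mul_idem hn hm hd ha hc]
    exact Submodule.smul_mem _ _ (Submodule.subset_span rfl)
  · rw [path_eq_zero hc]
    exact zero_mem _

/-- Prolonging a path at its beginning. -/
theorem path_mul_scaledArrow (hn : 1 ≤ n) (hm : 3 ≤ m) (hd : IsAdmissible m d)
    {a c : Fin (n + 1) → ℤ} {t : Fin (n + 1)} (ha : IsPoint m i a)
    (hat : IsPoint m i (a + basisVec t)) (hc : InCube m i (a + basisVec t) c) :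
    path m d i (a + basisVec t) c * scaledArrow m d i t a = path m d i a c := by
  refine InCube.induction hn hm hat.2
    (P := fun c => path m d i (a + basisVec t) c * scaledArrow m d i t a = path m d i a c)
    ?_ ?_ hc
  · rw [path_self hat.2, ← scaledArrow_mul_path hn hm hd ha (inCube_self ha.2), path_self ha.2,
      scaledArrow, smul_mul_assoc, mul_smul_comm, ← step_shift, idem_mul_arrow_self,
      arrow_mul_idem_self]
  · intro c s hc hcs h
    rw [← scaledArrow_mul_path hn hm hd hat hc, mul_assoc, h]
    have hac : a ≤ c := (le_add_of_nonneg_right (basisVec_nonneg t)).trans hc.1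
    by_cases hca : InCube m i a c
    · rw [scaledArrow_mul_path hn hm hd ha hca]
    · rw [path_eq_zero hca, mul_zero, path_eq_zero]
      intro h1
      refine hca ⟨hac, fun u => (le_trans ?_ (h1.2.1 u)), hc.2.2⟩
      exact le_add_of_nonneg_right (basisVec_nonneg s u)

end Paths

/-! ### Path elements form a basis of the projectives -/

section Model

variable {k : Type u} [Field k] {n m : ℕ} {d : Coeff k n} {i : Fin n → ℤ}

open Classical in
/-- The vertex at which the basis vector `c` of the model space is placed. It is the vertex below
`c`; points that do not lie over a vertex are placed at `i`, so that the idempotents still add up to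
the identity. -/
noncomputable def modelVertex (m : ℕ) (i : Fin n → ℤ) (c : Fin (n + 1) → ℤ) : Fin n → ℤ :=
  if IsVertex m (shift i c) then shift i c else i

theorem isVertex_modelVertex (hi : IsVertex m i) (c : Fin (n + 1) → ℤ) :
    IsVertex m (modelVertex m i c) := by
  unfold modelVertex
  split_ifs with h
  · exact h
  · exact hi

theorem modelVertex_of_isVertex {c : Fin (n + 1) → ℤ} (h : IsVertex m (shift i c)) :
    modelVertex m i c = shift i c := if_pos h

open Classical in
/-- The action of the idempotent at `j` on the model space. -/
noncomputable def modelIdem (k : Type u) [Field k] (m : ℕ) (i : Fin n → ℤ) (j : Fin n → ℤ) :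
    Module.End k ((Fin (n + 1) → ℤ) →₀ k) :=
  Finsupp.linearCombination k fun c => if modelVertex m i c = j then Finsupp.single c 1 else 0

open Classical in
/-- The action of the arrow of type `t` at `j` on the model space. Only the basis vectors in the
cube at `a` are moved. -/
noncomputable def modelArrow (m : ℕ) (d : Coeff k n) (i : Fin n → ℤ) (a : Fin (n + 1) → ℤ)
    (t : Fin (n + 1)) (j : Fin n → ℤ) : Module.End k ((Fin (n + 1) → ℤ) →₀ k) :=
  Finsupp.linearCombination k fun c =>
    if shift i c = j ∧ InCube m i a c ∧ InCube m i a (c + basisVec t) then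
      Finsupp.single (c + basisVec t) (lam m d i t c) else 0

open Classical in
theorem modelIdem_single (j : Fin n → ℤ) (c : Fin (n + 1) → ℤ) (x : k) :
    modelIdem k m i j (Finsupp.single c x) =
      if modelVertex m i c = j then Finsupp.single c x else 0 := by
  rw [modelIdem, Finsupp.linearCombination_single]
  split_ifs <;> simp

open Classical in
theorem modelArrow_single (a : Fin (n + 1) → ℤ) (t : Fin (n + 1)) (j : Fin n → ℤ)
    (c : Fin (n + 1) → ℤ) (x : k) :
    modelArrow m d i a t j (Finsupp.single c x) =
      if shift i c = j ∧ InCube m i a c ∧ InCube m i a (c + basisVec t) then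
        Finsupp.single (c + basisVec t) (x * lam m d i t c) else 0 := by
  rw [modelArrow, Finsupp.linearCombination_single]
  split_ifs <;> simp

/-- The action of the free generators on the model space. -/
noncomputable def modelFree (m : ℕ) (d : Coeff k n) (i : Fin n → ℤ) (a : Fin (n + 1) → ℤ) :
    FreeAlgebra k (Vertex n m ⊕ Arrow n m) →ₐ[k] Module.End k ((Fin (n + 1) → ℤ) →₀ k) :=
  FreeAlgebra.lift k
    (Sum.elim (fun v => modelIdem k m i v.1) fun p => modelArrow m d i a p.1.1 p.1.2)

theorem modelFree_freeIdem (hi : IsVertex m i) (a : Fin (n + 1) → ℤ) (j : Fin n → ℤ) :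
    modelFree m d i a (freeIdem k m j) = modelIdem k m i j := by
  by_cases h : IsVertex m j
  · simp [freeIdem, h, modelFree]
  · rw [freeIdem, dif_neg h, map_zero]
    refine Finsupp.lhom_ext fun c x => ?_
    rw [modelIdem_single, if_neg]
    · rfl
    · rintro rfl
      exact h (isVertex_modelVertex hi c)

theorem modelFree_freeArrow (a : Fin (n + 1) → ℤ) (t : Fin (n + 1)) (j : Fin n → ℤ) :
    modelFree m d i a (freeArrow k m t j) = modelArrow m d i a t j := by
  by_cases h : IsVertex m j ∧ IsVertex m (step t j)
  · rw [freeArrow, dif_pos h]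
    simp [modelFree]
  · rw [freeArrow, dif_neg h, map_zero]
    refine Finsupp.lhom_ext fun c x => ?_
    rw [modelArrow_single, if_neg]
    · rfl
    · rintro ⟨rfl, h1, h2⟩
      rw [step_shift] at h
      exact h ⟨h1.2.2, h2.2.2⟩

theorem InCube.between {a c c' c'' : Fin (n + 1) → ℤ} (hc : InCube m i a c)
    (hc'' : InCube m i a c'') (h : c ≤ c') (h' : c' ≤ c'') (hv : IsVertex m (shift i c')) :
    InCube m i a c' :=
  ⟨hc.1.trans h, h'.trans hc''.2.1, hv⟩

theorem le_add_basisVec (c : Fin (n + 1) → ℤ) (t : Fin (n + 1)) : c ≤ c + basisVec t :=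
  le_add_of_nonneg_right (basisVec_nonneg t)

/-- The model space is a module over the stable pyramid algebra. -/
theorem modelFree_rel (hn : 1 ≤ n) (hd : IsAdmissible m d) (hi : IsVertex m i)
    {a : Fin (n + 1) → ℤ} (ha : IsPoint m i a) {x y : FreeAlgebra k (Vertex n m ⊕ Arrow n m)}
    (h : Rel m d x y) : modelFree m d i a x = modelFree m d i a y := by
  classical
  cases h with
  | idem_mul_self j =>
    rw [map_mul, modelFree_freeIdem hi]
    refine Finsupp.lhom_ext fun c x => ?_
    simp only [Module.End.mul_apply, modelIdem_single]
    split_ifs with h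
    · rw [modelIdem_single, if_pos h]
    · rw [map_zero]
  | idem_mul_idem j j' hj =>
    rw [map_mul, modelFree_freeIdem hi, modelFree_freeIdem hi, map_zero]
    refine Finsupp.lhom_ext fun c x => ?_
    simp only [Module.End.mul_apply, modelIdem_single, LinearMap.zero_apply]
    split_ifs with h
    · rw [modelIdem_single, if_neg]
      rw [h]
      exact fun h' => hj (Subtype.ext h'.symm)
    · rw [map_zero]
  | sum_idem =>
    rw [map_sum, map_one]
    refine Finsupp.lhom_ext fun c x => ?_
    simp only [LinearMap.sum_apply, modelFree_freeIdem hi, modelIdem_single, Module.End.one_apply]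
    rw [Finset.sum_eq_single (⟨modelVertex m i c, isVertex_modelVertex hi c⟩ : Vertex n m)]
    · simp
    · intro j _ hj
      rw [if_neg]
      exact fun h' => hj (Subtype.ext h'.symm)
    · exact fun h => absurd (Finset.mem_univ _) h
  | arrow_mul_source p =>
    rw [map_mul, modelFree_freeIdem hi, modelFree_freeArrow]
    refine Finsupp.lhom_ext fun c x => ?_
    simp only [Module.End.mul_apply, modelIdem_single]
    split_ifs with h
    · rfl
    · rw [map_zero, modelArrow_single, if_neg]
      rintro ⟨h1, h2, -⟩
      exact h (by rw [modelVertex_of_isVertex h2.2.2, h1])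
  | target_mul_arrow p =>
    rw [map_mul, modelFree_freeIdem hi, modelFree_freeArrow]
    refine Finsupp.lhom_ext fun c x => ?_
    simp only [Module.End.mul_apply, modelArrow_single]
    split_ifs with h
    · rw [modelIdem_single, if_pos]
      rw [modelVertex_of_isVertex h.2.2.2.2, ← step_shift, h.1]
    · rw [map_zero]
  | same_type t j h₀ h₁ h₂ =>
    rw [map_mul, modelFree_freeArrow, modelFree_freeArrow, map_zero]
    refine Finsupp.lhom_ext fun c x => ?_
    simp only [Module.End.mul_apply, modelArrow_single, LinearMap.zero_apply]
    split_ifs with h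
    · rw [modelArrow_single, if_neg]
      rintro ⟨-, -, h3⟩
      have h4 := h.2.1.1 t
      have h5 := h3.2.1 t
      simp [basisVec_apply] at h5
      linarith
    · rw [map_zero]
  | square s t j hts hsq =>
    rw [map_smul, map_mul, map_mul]
    simp only [modelFree_freeArrow]
    refine Finsupp.lhom_ext fun c x => ?_
    simp only [Module.End.mul_apply, LinearMap.smul_apply, modelArrow_single]
    have hcomm : c + basisVec s + basisVec t = c + basisVec t + basisVec s := by abel
    by_cases h : shift i c = j ∧ InCube m i a c ∧ InCube m i a (c + basisVec t + basisVec s)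
    · obtain ⟨rfl, h1, h2⟩ := h
      obtain ⟨-, hvt, hvs, -⟩ := hsq
      rw [step_shift] at hvt hvs
      have h3 : InCube m i a (c + basisVec t) :=
        h1.between h2 (le_add_basisVec _ _) (le_add_basisVec _ _) hvt
      have h4 : InCube m i a (c + basisVec s) :=
        h1.between h2 (le_add_basisVec _ _) (by rw [← hcomm]; exact le_add_basisVec _ _) hvs
      rw [if_pos ⟨rfl, h1, h4⟩, if_pos ⟨rfl, h1, h3⟩, modelArrow_single, modelArrow_single,
        if_pos ⟨(step_shift _ _ _).symm, h4, by rwa [hcomm]⟩,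
        if_pos ⟨(step_shift _ _ _).symm, h3, h2⟩, hcomm, Finsupp.smul_single]
      have := lam_square hn hd hts (h1.isPoint ha.1) (h3.isPoint ha.1) (h4.isPoint ha.1)
      congr 1
      rw [smul_eq_mul]
      linear_combination -x * this
    · -- both paths leave the cube or start at a different vertex
      have z1 : modelArrow m d i a t (step s j)
          (if shift i c = j ∧ InCube m i a c ∧ InCube m i a (c + basisVec s) then
            Finsupp.single (c + basisVec s) (x * lam m d i s c) else 0) = 0 := by
        split_ifs with h1
        · rw [modelArrow_single, if_neg]
          rintro ⟨-, -, h2⟩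
          exact h ⟨h1.1, h1.2.1, by rwa [← hcomm]⟩
        · rw [map_zero]
      have z2 : modelArrow m d i a s (step t j)
          (if shift i c = j ∧ InCube m i a c ∧ InCube m i a (c + basisVec t) then
            Finsupp.single (c + basisVec t) (x * lam m d i t c) else 0) = 0 := by
        split_ifs with h1
        · rw [modelArrow_single, if_neg]
          rintro ⟨-, -, h2⟩
          exact h ⟨h1.1, h1.2.1, h2⟩
        · rw [map_zero]
      rw [z1, z2, smul_zero]

/-- There are linear coordinates on the algebra in which the path elements starting at `a` are the
standard basis vectors. They are obtained by letting the algebra act on the basis vector `a` of the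
model space. -/
theorem exists_coord (hn : 1 ≤ n) (hm : 3 ≤ m) (hd : IsAdmissible m d) (hi : IsVertex m i)
    {a : Fin (n + 1) → ℤ} (ha : IsPoint m i a) :
    ∃ κ : StableAlg m d →ₗ[k] ((Fin (n + 1) → ℤ) →₀ k),
      ∀ c, InCube m i a c → κ (path m d i a c) = Finsupp.single c 1 := by
  let ρ : StableAlg m d →ₐ[k] Module.End k ((Fin (n + 1) → ℤ) →₀ k) :=
    RingQuot.liftAlgHom k ⟨modelFree m d i a, fun _ _ h => modelFree_rel hn hd hi ha h⟩
  have hρ : ∀ x, ρ (quotMap m d x) = modelFree m d i a x := fun x =>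
    RingQuot.liftAlgHom_mkAlgHom_apply k _ _ _
  refine ⟨(LinearMap.applyₗ (Finsupp.single a (1 : k))).comp ρ.toLinearMap, fun c hc => ?_⟩
  refine InCube.induction hn hm ha.2 (P := fun c => (LinearMap.applyₗ (Finsupp.single a (1 : k)))
    (ρ (path m d i a c)) = Finsupp.single c 1) ?_ ?_ hc
  · rw [path_self ha.2, ← quotMap_freeIdem, hρ, modelFree_freeIdem hi, LinearMap.applyₗ_apply_apply,
      modelIdem_single, if_pos (modelVertex_of_isVertex ha.2)]
  · intro c t hc hct h
    rw [LinearMap.applyₗ_apply_apply] at h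
    rw [← scaledArrow_mul_path hn hm hd ha hc, map_mul, LinearMap.applyₗ_apply_apply,
      Module.End.mul_apply, h, scaledArrow, map_smul, ← quotMap_freeArrow, hρ,
      modelFree_freeArrow, LinearMap.smul_apply, modelArrow_single, if_pos ⟨rfl, hc, hct⟩,
      Finsupp.smul_single, one_mul, smul_eq_mul,
      inv_mul_cancel₀ (lam_ne_zero hn hd (hc.isPoint ha.1) (hct.isPoint ha.1))]

open Classical in
/-- Coordinates with respect to the path elements starting at `a`. -/
noncomputable def coord (m : ℕ) (d : Coeff k n) (i : Fin n → ℤ) (a : Fin (n + 1) → ℤ) :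
    StableAlg m d →ₗ[k] ((Fin (n + 1) → ℤ) →₀ k) :=
  if h : ∃ κ : StableAlg m d →ₗ[k] ((Fin (n + 1) → ℤ) →₀ k),
      ∀ c, InCube m i a c → κ (path m d i a c) = Finsupp.single c 1 then h.choose else 0

theorem coord_path (hn : 1 ≤ n) (hm : 3 ≤ m) (hd : IsAdmissible m d) (hi : IsVertex m i)
    {a c : Fin (n + 1) → ℤ} (ha : IsPoint m i a) (hc : InCube m i a c) :
    coord m d i a (path m d i a c) = Finsupp.single c 1 := by
  have h := exists_coord hn hm hd hi ha
  rw [coord, dif_pos h]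
  exact h.choose_spec c hc

open Classical in
/-- The points of the cube at `a`, as a finite set. -/
noncomputable def cubePoints (m : ℕ) (i : Fin n → ℤ) (a : Fin (n + 1) → ℤ) :
    Finset (Fin (n + 1) → ℤ) :=
  (Finset.Icc a (a + 1)).filter fun c => IsVertex m (shift i c)

theorem mem_cubePoints {a c : Fin (n + 1) → ℤ} : c ∈ cubePoints m i a ↔ InCube m i a c := by
  simp [cubePoints, InCube, and_assoc]

theorem arrow_mul_path_of_ne (hn : 1 ≤ n) (hm : 3 ≤ m) (hd : IsAdmissible m d)
    {a c : Fin (n + 1) → ℤ} (ha : IsPoint m i a) (hc : InCube m i a c) (t : Fin (n + 1))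
    {j : Fin n → ℤ} (hj : j ≠ shift i c) : arrow m d t j * path m d i a c = 0 := by
  rw [← idem_mul_path hn hm hd ha hc, ← mul_assoc, arrow_mul_idem_of_ne t hj, zero_mul]

/-- The path elements starting at `a` span the projective at the vertex below `a`. -/
theorem mem_span_path (hn : 1 ≤ n) (hm : 3 ≤ m) (hd : IsAdmissible m d)
    {a : Fin (n + 1) → ℤ} (ha : IsPoint m i a) {y : StableAlg m d}
    (hy : y ∈ Proj m d (shift i a)) :
    y ∈ Submodule.span k (Set.range (path m d i a)) := by
  obtain ⟨z, rfl⟩ := Submodule.mem_span_singleton.1 hy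
  have hmem : ∀ c, path m d i a c ∈ Submodule.span k (Set.range (path m d i a)) := fun c =>
    Submodule.subset_span ⟨c, rfl⟩
  refine mul_mem_of_stable _ ?_ ?_ z _ (by rw [← path_self ha.2]; exact hmem a)
  · intro j x hx
    induction hx using Submodule.span_induction with
    | mem x hx =>
      obtain ⟨c, rfl⟩ := hx
      by_cases hc : InCube m i a c
      · rw [← idem_mul_path hn hm hd ha hc]
        by_cases hj : j = shift i c
        · rw [hj, ← mul_assoc, idem_mul_idem_self, idem_mul_path hn hm hd ha hc]
          exact hmem c
        · rw [← mul_assoc, idem_mul_idem_of_ne hj, zero_mul]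
          exact zero_mem _
      · rw [path_eq_zero hc, mul_zero]
        exact zero_mem _
    | zero => rw [mul_zero]; exact zero_mem _
    | add x y _ _ hx hy => rw [mul_add]; exact add_mem hx hy
    | smul r x _ hx => rw [mul_smul_comm]; exact Submodule.smul_mem _ _ hx
  · intro t j x hx
    induction hx using Submodule.span_induction with
    | mem x hx =>
      obtain ⟨c, rfl⟩ := hx
      by_cases hc : InCube m i a c
      · by_cases hj : j = shift i c
        · rw [hj, arrow_mul_path hn hm hd ha hc]
          exact Submodule.smul_mem _ _ (hmem _)
        · rw [arrow_mul_path_of_ne hn hm hd ha hc t hj]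
          exact zero_mem _
      · rw [path_eq_zero hc, mul_zero]
        exact zero_mem _
    | zero => rw [mul_zero]; exact zero_mem _
    | add x y _ _ hx hy => rw [mul_add]; exact add_mem hx hy
    | smul r x _ hx => rw [mul_smul_comm]; exact Submodule.smul_mem _ _ hx

theorem eq_sum_coord (hn : 1 ≤ n) (hm : 3 ≤ m) (hd : IsAdmissible m d) (hi : IsVertex m i)
    {a : Fin (n + 1) → ℤ} (ha : IsPoint m i a) {y : StableAlg m d}
    (hy : y ∈ Proj m d (shift i a)) :
    y = ∑ c ∈ cubePoints m i a, coord m d i a y c • path m d i a c := by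
  have h := mem_span_path hn hm hd ha hy
  clear hy
  induction h using Submodule.span_induction with
  | mem x hx =>
    obtain ⟨c, rfl⟩ := hx
    by_cases hc : InCube m i a c
    · rw [coord_path hn hm hd hi ha hc, Finset.sum_eq_single c]
      · simp
      · intro c' _ h'
        rw [Finsupp.single_eq_of_ne h', zero_smul]
      · exact fun h => absurd (mem_cubePoints.2 hc) h
    · simp [path_eq_zero hc]
  | zero => simp
  | add x y _ _ hx hy =>
    simp only [map_add, Finsupp.add_apply, add_smul, Finset.sum_add_distrib]
    rw [← hx, ← hy]
  | smul r x _ hx =>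
    simp only [map_smul, Finsupp.smul_apply, smul_assoc, ← Finset.smul_sum]
    rw [← hx]

theorem coord_eq_zero (hn : 1 ≤ n) (hm : 3 ≤ m) (hd : IsAdmissible m d) (hi : IsVertex m i)
    {a c : Fin (n + 1) → ℤ} (ha : IsPoint m i a) {y : StableAlg m d}
    (hy : y ∈ Proj m d (shift i a)) (hc : ¬ InCube m i a c) : coord m d i a y c = 0 := by
  rw [eq_sum_coord hn hm hd hi ha hy, map_sum, Finsupp.finsetSum_apply]
  refine Finset.sum_eq_zero fun c' hc' => ?_
  rw [mem_cubePoints] at hc'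
  rw [map_smul, coord_path hn hm hd hi ha hc', Finsupp.smul_apply, Finsupp.single_eq_of_ne,
    smul_zero]
  rintro rfl
  exact hc hc'

/-- Right multiplication by a rescaled arrow preserves the coordinates. -/
theorem coord_mul_scaledArrow (hn : 1 ≤ n) (hm : 3 ≤ m) (hd : IsAdmissible m d)
    (hi : IsVertex m i) {a c : Fin (n + 1) → ℤ} {t : Fin (n + 1)} (ha : IsPoint m i a)
    (hat : IsPoint m i (a + basisVec t)) (hc : InCube m i a c) {y : StableAlg m d}
    (hy : y ∈ Proj m d (shift i (a + basisVec t))) :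
    coord m d i a (y * scaledArrow m d i t a) c = coord m d i (a + basisVec t) y c := by
  have h1 := eq_sum_coord hn hm hd hi hat hy
  have h2 : y * scaledArrow m d i t a = ∑ c' ∈ cubePoints m i (a + basisVec t),
      coord m d i (a + basisVec t) y c' • path m d i a c' := by
    conv_lhs => rw [h1]
    rw [Finset.sum_mul]
    refine Finset.sum_congr rfl fun c' hc' => ?_
    rw [smul_mul_assoc, path_mul_scaledArrow hn hm hd ha hat (mem_cubePoints.1 hc')]
  rw [h2, map_sum, Finsupp.finsetSum_apply]
  simp only [map_smul, Finsupp.smul_apply, smul_eq_mul]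
  have h3 : ∀ c', c' ≠ c → coord m d i a (path m d i a c') c = 0 := by
    intro c' hne
    by_cases h : InCube m i a c'
    · rw [coord_path hn hm hd hi ha h, Finsupp.single_eq_of_ne hne.symm]
    · rw [path_eq_zero h, map_zero, Finsupp.zero_apply]
  rw [Finset.sum_eq_single c]
  · rw [coord_path hn hm hd hi ha hc, Finsupp.single_eq_same, mul_one]
  · intro c' _ hne
    rw [h3 c' hne, mul_zero]
  · intro h
    rw [coord_eq_zero hn hm hd hi hat hy (fun h' => h (mem_cubePoints.2 h')), zero_mul]

end Model

/-! ### The terms of the complex in coordinates -/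

section Terms

variable {k : Type u} [Field k] {n m : ℕ} {d : Coeff k n} {i : Fin n → ℤ}

theorem mem_cuboidNet {l : ℕ} {a : Fin (n + 1) → ℤ} :
    a ∈ cuboidNet m i l ↔ 0 ≤ a ∧ a ≤ sides m i ∧ ∑ t, a t = (l : ℤ) := by
  simp [cuboidNet, and_assoc]

theorem isPoint_of_le_sides (hn : 1 ≤ n) {a : Fin (n + 1) → ℤ} (h0 : 0 ≤ a)
    (hb : a ≤ sides m i) : IsPoint m i a := by
  refine ⟨h0, (isVertex_shift_iff hn a).2 fun t => ?_⟩
  have h1 : a t ≤ sides m i t := hb t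
  have h2 : 0 ≤ a (t - 1) := h0 (t - 1)
  linarith

theorem isPoint_of_mem (hn : 1 ≤ n) {l : ℕ} {a : Fin (n + 1) → ℤ} (ha : a ∈ cuboidNet m i l) :
    IsPoint m i a :=
  isPoint_of_le_sides hn (mem_cuboidNet.1 ha).1 (mem_cuboidNet.1 ha).2.1

/-- The component at `a` of an element of the `l`-th term, and `0` if `a` is not an index. -/
noncomputable def comp (m : ℕ) (d : Coeff k n) (i : Fin n → ℤ) (l : ℕ) (a : Fin (n + 1) → ℤ) :
    Term m d i l →ₗ[StableAlg m d] StableAlg m d :=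
  if h : a ∈ cuboidNet m i l then
    (Proj m d (shift i a)).subtype ∘ₗ DirectSum.component (StableAlg m d) (cuboidNet m i l)
      (fun a : cuboidNet m i l => Proj m d (shift i a.1)) ⟨a, h⟩
  else 0

theorem comp_apply {l : ℕ} {a : Fin (n + 1) → ℤ} (h : a ∈ cuboidNet m i l) (x : Term m d i l) :
    comp m d i l a x = (x ⟨a, h⟩ : StableAlg m d) := by
  rw [comp, dif_pos h]
  rfl

theorem comp_of_notMem {l : ℕ} {a : Fin (n + 1) → ℤ} (h : a ∉ cuboidNet m i l)
    (x : Term m d i l) : comp m d i l a x = 0 := by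
  rw [comp, dif_neg h, LinearMap.zero_apply]

theorem comp_mem {l : ℕ} (a : Fin (n + 1) → ℤ) (x : Term m d i l) :
    comp m d i l a x ∈ Proj m d (shift i a) := by
  by_cases h : a ∈ cuboidNet m i l
  · rw [comp_apply h]
    exact (x ⟨a, h⟩).2
  · rw [comp_of_notMem h]
    exact zero_mem _

theorem term_ext {l : ℕ} {x y : Term m d i l}
    (h : ∀ a ∈ cuboidNet m i l, comp m d i l a x = comp m d i l a y) : x = y := by
  refine DFinsupp.ext fun a => Subtype.ext ?_
  have := h a.1 a.2
  rwa [comp_apply a.2, comp_apply a.2] at this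

theorem comp_gen {l : ℕ} (a a' : Fin (n + 1) → ℤ) (h : a ∈ cuboidNet m i l) :
    comp m d i l a' (gen m d i l a) = if a' = a then idem m d (shift i a) else 0 := by
  rw [gen, dif_pos h]
  by_cases h' : a' ∈ cuboidNet m i l
  · rw [comp_apply h']
    split_ifs with haa
    · subst haa
      rw [DirectSum.lof_apply]
      rfl
    · rw [DirectSum.lof_eq_of, DirectSum.of_eq_of_ne]
      · rfl
      · exact fun h => haa (congrArg Subtype.val h)
  · rw [comp_of_notMem h', if_neg]
    rintro rfl
    exact h' h

theorem gen_of_notMem {l : ℕ} {a : Fin (n + 1) → ℤ} (h : a ∉ cuboidNet m i l) :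
    gen m d i l a = 0 := dif_neg h

theorem mul_idem_of_mem {y : StableAlg m d} {j : Fin n → ℤ} (hy : y ∈ Proj m d j) :
    y * idem m d j = y := by
  obtain ⟨z, rfl⟩ := Submodule.mem_span_singleton.1 hy
  rw [smul_eq_mul, mul_assoc, idem_mul_idem_self]

/-- Every element of a term is the combination of the standard generators with its components. -/
theorem eq_sum_comp_smul_gen {l : ℕ} (x : Term m d i l) :
    x = ∑ a ∈ cuboidNet m i l, comp m d i l a x • gen m d i l a := by
  refine term_ext fun a ha => ?_
  rw [map_sum, Finset.sum_eq_single a]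
  · rw [map_smul, comp_gen a a ha, if_pos rfl, smul_eq_mul, mul_idem_of_mem (comp_mem a x)]
  · intro a' ha' hne
    rw [map_smul, comp_gen a' a ha', if_neg hne.symm, smul_zero]
  · exact fun h => absurd ha h

/-- The linear map on a term that sends the standard generator at `a` to `e • v a`, where `e` is the
idempotent at the vertex below `a`. -/
noncomputable def termLift (m : ℕ) (d : Coeff k n) (i : Fin n → ℤ) (l : ℕ) {M : Type*}
    [AddCommGroup M] [Module (StableAlg m d) M] (v : (Fin (n + 1) → ℤ) → M) :
    Term m d i l →ₗ[StableAlg m d] M :=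
  DirectSum.toModule (StableAlg m d) (cuboidNet m i l) M fun a =>
    (LinearMap.toSpanSingleton (StableAlg m d) M (v a.1)).comp (Proj m d (shift i a.1)).subtype

theorem termLift_gen {l : ℕ} {M : Type*} [AddCommGroup M] [Module (StableAlg m d) M]
    (v : (Fin (n + 1) → ℤ) → M) {a : Fin (n + 1) → ℤ} (ha : a ∈ cuboidNet m i l) :
    termLift m d i l v (gen m d i l a) = idem m d (shift i a) • v a := by
  rw [gen, dif_pos ha, termLift, DirectSum.toModule_lof]
  rfl

theorem termLift_apply {l : ℕ} {M : Type*} [AddCommGroup M] [Module (StableAlg m d) M]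
    (v : (Fin (n + 1) → ℤ) → M) (x : Term m d i l) :
    termLift m d i l v x = ∑ a ∈ cuboidNet m i l, comp m d i l a x • v a := by
  conv_lhs => rw [eq_sum_comp_smul_gen x]
  rw [map_sum]
  refine Finset.sum_congr rfl fun a ha => ?_
  rw [map_smul, termLift_gen v ha, smul_smul, mul_idem_of_mem (comp_mem a x)]

/-- Coordinates on a term: the coefficient of the path from `a` to `c` in the component at `a`. -/
noncomputable def tcoord (m : ℕ) (d : Coeff k n) (i : Fin n → ℤ) (l : ℕ) (x : Term m d i l)
    (a c : Fin (n + 1) → ℤ) : k :=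
  coord m d i a (comp m d i l a x) c

theorem tcoord_eq_zero (hn : 1 ≤ n) (hm : 3 ≤ m) (hd : IsAdmissible m d) (hi : IsVertex m i)
    {l : ℕ} (x : Term m d i l) {a c : Fin (n + 1) → ℤ}
    (h : ¬ (a ∈ cuboidNet m i l ∧ InCube m i a c)) : tcoord m d i l x a c = 0 := by
  rw [tcoord]
  by_cases ha : a ∈ cuboidNet m i l
  · exact coord_eq_zero hn hm hd hi (isPoint_of_mem hn ha) (comp_mem a x) fun hc => h ⟨ha, hc⟩
  · rw [comp_of_notMem ha, map_zero, Finsupp.zero_apply]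

theorem tcoord_ext (hn : 1 ≤ n) (hm : 3 ≤ m) (hd : IsAdmissible m d) (hi : IsVertex m i)
    {l : ℕ} {x y : Term m d i l}
    (h : ∀ a ∈ cuboidNet m i l, ∀ c, InCube m i a c →
      tcoord m d i l x a c = tcoord m d i l y a c) : x = y := by
  refine term_ext fun a ha => ?_
  rw [eq_sum_coord hn hm hd hi (isPoint_of_mem hn ha) (comp_mem a x),
    eq_sum_coord hn hm hd hi (isPoint_of_mem hn ha) (comp_mem a y)]
  exact Finset.sum_congr rfl fun c hc => by
    rw [show coord m d i a (comp m d i l a x) c = coord m d i a (comp m d i l a y) c from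
      h a ha c (mem_cubePoints.1 hc)]

theorem exists_tcoord_eq (hn : 1 ≤ n) (hm : 3 ≤ m) (hd : IsAdmissible m d) (hi : IsVertex m i)
    (l : ℕ) (Y : (Fin (n + 1) → ℤ) → (Fin (n + 1) → ℤ) → k) :
    ∃ x : Term m d i l, ∀ a ∈ cuboidNet m i l, ∀ c, InCube m i a c →
      tcoord m d i l x a c = Y a c := by
  refine ⟨∑ a ∈ cuboidNet m i l,
    (∑ c ∈ cubePoints m i a, Y a c • path m d i a c) • gen m d i l a, fun a ha c hc => ?_⟩
  have hap := isPoint_of_mem hn ha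
  have h1 : comp m d i l a (∑ a ∈ cuboidNet m i l,
      (∑ c ∈ cubePoints m i a, Y a c • path m d i a c) • gen m d i l a) =
      ∑ c ∈ cubePoints m i a, Y a c • path m d i a c := by
    rw [map_sum, Finset.sum_eq_single a]
    · rw [map_smul, comp_gen a a ha, if_pos rfl, smul_eq_mul, mul_idem_of_mem]
      refine Submodule.sum_mem _ fun c _ => ?_
      rw [← smul_one_mul]
      exact Submodule.smul_mem _ _ (path_mem_proj hn hm hd hap c)
    · intro a' ha' hne
      rw [map_smul, comp_gen a' a ha', if_neg hne.symm, smul_zero]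
    · exact fun h => absurd ha h
  rw [tcoord, h1, map_sum, Finsupp.finsetSum_apply, Finset.sum_eq_single c]
  · rw [map_smul, coord_path hn hm hd hi hap hc, Finsupp.smul_apply, Finsupp.single_eq_same,
      smul_eq_mul, mul_one]
  · intro c' hc' hne
    rw [map_smul, coord_path hn hm hd hi hap (mem_cubePoints.1 hc'), Finsupp.smul_apply,
      Finsupp.single_eq_of_ne hne.symm, smul_zero]
  · exact fun h => absurd (mem_cubePoints.2 hc) h

/-- An element is the sum of the paths weighted by its coordinates. -/
theorem eq_sum_tcoord (hn : 1 ≤ n) (hm : 3 ≤ m) (hd : IsAdmissible m d) (hi : IsVertex m i)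
    {l : ℕ} (x : Term m d i l) :
    x = ∑ a ∈ cuboidNet m i l, ∑ c ∈ cubePoints m i a,
      (tcoord m d i l x a c • path m d i a c) • gen m d i l a := by
  conv_lhs => rw [eq_sum_comp_smul_gen x]
  refine Finset.sum_congr rfl fun a ha => ?_
  rw [← Finset.sum_smul]
  congr 1
  exact eq_sum_coord hn hm hd hi (isPoint_of_mem hn ha) (comp_mem a x)

end Terms

/-! ### The differential -/

section Differential

variable {k : Type u} [Field k] {n m : ℕ} {d : Coeff k n} {i : Fin n → ℤ}

/-- The Koszul sign `(-1) ^ (a_1 + ⋯ + a_{t-1})`. -/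
noncomputable def koszulSign (k : Type u) [Field k] (a : Fin (n + 1) → ℤ) (t : Fin (n + 1)) : k :=
  (-1) ^ (∑ s ∈ Finset.Iio t, a s)

theorem koszulSign_ne_zero (a : Fin (n + 1) → ℤ) (t : Fin (n + 1)) : koszulSign k a t ≠ 0 :=
  zpow_ne_zero _ (neg_ne_zero.2 one_ne_zero)

theorem koszulSign_mul_self (a : Fin (n + 1) → ℤ) (t : Fin (n + 1)) :
    koszulSign k a t * koszulSign k a t = 1 := by
  rw [koszulSign, ← mul_zpow]
  simp

theorem koszulSign_add (a : Fin (n + 1) → ℤ) (s t : Fin (n + 1)) :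
    koszulSign k (a + basisVec s) t = if s < t then -koszulSign k a t else koszulSign k a t := by
  have h : ∑ u ∈ Finset.Iio t, (a + basisVec s) u =
      ∑ u ∈ Finset.Iio t, a u + if s < t then 1 else 0 := by
    simp only [Pi.add_apply, Finset.sum_add_distrib, basisVec_apply]
    simp
  rw [koszulSign, h]
  split_ifs with hst
  · rw [zpow_add_one₀ (neg_ne_zero.2 one_ne_zero), koszulSign, mul_neg_one]
  · rw [add_zero, koszulSign]

/-- The sign rule behind the contracting homotopies: exactly one of `s < t` and `t < s` holds. -/
theorem koszulSign_swap (a : Fin (n + 1) → ℤ) {s t : Fin (n + 1)} (hst : s ≠ t) :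
    koszulSign k (a + basisVec s + basisVec t) t * koszulSign k (a + basisVec s + basisVec t) s =
      -(koszulSign k (a + basisVec s) s * koszulSign k (a + basisVec t) t) := by
  simp only [koszulSign_add, lt_irrefl, if_false]
  rcases lt_or_gt_of_ne hst with h | h
  · simp [h, h.not_gt]; ring
  · simp [h, h.not_gt]; ring

/-- The sign rule behind the vanishing of the composition of two differentials. -/
theorem koszulSign_anticomm (a : Fin (n + 1) → ℤ) {s t : Fin (n + 1)} (hst : s ≠ t) :
    koszulSign k (a + basisVec t) t * koszulSign k (a + basisVec t + basisVec s) s =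
      -(koszulSign k (a + basisVec s) s * koszulSign k (a + basisVec t + basisVec s) t) := by
  simp only [koszulSign_add, lt_irrefl, if_false]
  rcases lt_or_gt_of_ne hst with h | h
  · simp [h, h.not_gt]; ring
  · simp [h, h.not_gt]; ring

/-- The scalars of the differential. -/
noncomputable def zeta (m : ℕ) (d : Coeff k n) (i : Fin n → ℤ) (l : ℕ) (a : Fin (n + 1) → ℤ)
    (t : Fin (n + 1)) : k :=
  if a - basisVec t ∈ cuboidNet m i l then
    koszulSign k a t * (lam m d i t (a - basisVec t))⁻¹ else 0

theorem zeta_ne_zero_iff (hn : 1 ≤ n) (hd : IsAdmissible m d) {l : ℕ} {a : Fin (n + 1) → ℤ}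
    (ha : a ∈ cuboidNet m i (l + 1)) (t : Fin (n + 1)) :
    zeta m d i l a t ≠ 0 ↔ a - basisVec t ∈ cuboidNet m i l := by
  rw [zeta]
  split_ifs with h
  · refine iff_of_true (mul_ne_zero (koszulSign_ne_zero a t) (inv_ne_zero ?_)) h
    exact lam_ne_zero hn hd (isPoint_of_mem hn h) (by
      rw [sub_add_cancel]; exact isPoint_of_mem hn ha)
  · exact iff_of_false (fun h => h rfl) h

theorem theta_zeta (l : ℕ) (a : Fin (n + 1) → ℤ) :
    theta m d i l (zeta m d i l) a = ∑ t, (koszulSign k a t • scaledArrow m d i t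
      (a - basisVec t)) • gen m d i l (a - basisVec t) := by
  rw [theta]
  refine Finset.sum_congr rfl fun t _ => ?_
  by_cases h : a - basisVec t ∈ cuboidNet m i l
  · rw [zeta, if_pos h, mul_smul]
    rfl
  · rw [gen_of_notMem h, smul_zero, smul_zero]

theorem idem_smul_theta (l : ℕ) (ζ : (Fin (n + 1) → ℤ) → Fin (n + 1) → k)
    (a : Fin (n + 1) → ℤ) :
    idem m d (shift i a) • theta m d i l ζ a = theta m d i l ζ a := by
  rw [theta, Finset.smul_sum]
  refine Finset.sum_congr rfl fun t _ => ?_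
  have h : idem m d (shift i a) * arrow m d t (shift i (a - basisVec t)) =
      arrow m d t (shift i (a - basisVec t)) := by
    have := idem_mul_arrow_self (d := d) (m := m) t (shift i (a - basisVec t))
    rwa [step_shift, sub_add_cancel] at this
  rw [smul_smul, mul_smul_comm, h]

/-- The differential of the complex. -/
noncomputable def diff (m : ℕ) (d : Coeff k n) (i : Fin n → ℤ) (l : ℕ) :
    Term m d i (l + 1) →ₗ[StableAlg m d] Term m d i l :=
  termLift m d i (l + 1) (theta m d i l (zeta m d i l))

theorem diff_gen {l : ℕ} {a : Fin (n + 1) → ℤ} (ha : a ∈ cuboidNet m i (l + 1)) :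
    diff m d i l (gen m d i (l + 1) a) = theta m d i l (zeta m d i l) a := by
  rw [diff, termLift_gen _ ha, idem_smul_theta]

theorem comp_diff {l : ℕ} (x : Term m d i (l + 1)) {a : Fin (n + 1) → ℤ}
    (ha : a ∈ cuboidNet m i l) :
    comp m d i l a (diff m d i l x) = ∑ t, koszulSign k (a + basisVec t) t •
      (comp m d i (l + 1) (a + basisVec t) x * scaledArrow m d i t a) := by
  have h1 : ∀ a', comp m d i l a (theta m d i l (zeta m d i l) a') =
      ∑ t, if a' = a + basisVec t then koszulSign k a' t • scaledArrow m d i t a else 0 := by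
    intro a'
    rw [theta_zeta, map_sum]
    refine Finset.sum_congr rfl fun t _ => ?_
    rw [map_smul]
    split_ifs with h
    · subst h
      rw [add_sub_cancel_right, comp_gen a a ha, if_pos rfl, smul_eq_mul, smul_mul_assoc,
        scaledArrow, smul_mul_assoc, arrow_mul_idem_self]
    · by_cases h' : a' - basisVec t ∈ cuboidNet m i l
      · rw [comp_gen _ a h', if_neg, smul_zero]
        rintro rfl
        exact h (by rw [sub_add_cancel])
      · rw [gen_of_notMem h', map_zero, smul_zero]
  rw [diff, termLift_apply, map_sum]
  simp only [map_smul, h1, smul_eq_mul, Finset.mul_sum]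
  rw [Finset.sum_comm]
  refine Finset.sum_congr rfl fun t _ => ?_
  simp only [mul_ite, mul_zero, Finset.sum_ite_eq']
  split_ifs with h
  · rw [mul_smul_comm]
  · rw [comp_of_notMem h, zero_mul, smul_zero]

/-- In coordinates the differential moves the starting points of the paths back and keeps their
end points, so it is the differential of a direct sum, over the end points `c`, of cube
complexes. -/
theorem tcoord_diff (hn : 1 ≤ n) (hm : 3 ≤ m) (hd : IsAdmissible m d) (hi : IsVertex m i)
    {l : ℕ} (x : Term m d i (l + 1)) {a c : Fin (n + 1) → ℤ} (ha : a ∈ cuboidNet m i l)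
    (hc : InCube m i a c) :
    tcoord m d i l (diff m d i l x) a c =
      ∑ t, koszulSign k (a + basisVec t) t * tcoord m d i (l + 1) x (a + basisVec t) c := by
  rw [tcoord, comp_diff x ha, map_sum, Finsupp.finsetSum_apply]
  refine Finset.sum_congr rfl fun t _ => ?_
  rw [map_smul, Finsupp.smul_apply, smul_eq_mul, tcoord]
  by_cases h : a + basisVec t ∈ cuboidNet m i (l + 1)
  · rw [coord_mul_scaledArrow hn hm hd hi (isPoint_of_mem hn ha) (isPoint_of_mem hn h) hc
      (comp_mem _ x)]
  · rw [comp_of_notMem h, zero_mul, map_zero, map_zero, Finsupp.zero_apply]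

end Differential

/-! ### Exactness -/

section Exactness

variable {k : Type u} [Field k] {n m : ℕ} {d : Coeff k n} {i : Fin n → ℤ}

theorem add_mem_cuboidNet {l : ℕ} {a : Fin (n + 1) → ℤ} {t : Fin (n + 1)}
    (ha : a ∈ cuboidNet m i l) (h : a t + 1 ≤ sides m i t) :
    a + basisVec t ∈ cuboidNet m i (l + 1) := by
  rw [mem_cuboidNet] at ha ⊢
  refine ⟨ha.1.trans (le_add_basisVec a t), fun s => ?_, ?_⟩
  · simp only [Pi.add_apply, basisVec_apply]
    split_ifs with hs
    · rwa [hs]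
    · simpa using ha.2.1 s
  · rw [sum_add_basisVec, ha.2.2]
    push_cast
    ring

theorem sub_mem_cuboidNet {l : ℕ} {a : Fin (n + 1) → ℤ} {t : Fin (n + 1)}
    (ha : a ∈ cuboidNet m i (l + 1)) (h : 1 ≤ a t) : a - basisVec t ∈ cuboidNet m i l := by
  rw [mem_cuboidNet] at ha ⊢
  refine ⟨fun s => ?_, (sub_le_self a (basisVec_nonneg t)).trans ha.2.1, ?_⟩
  · simp only [Pi.sub_apply, Pi.zero_apply, basisVec_apply]
    split_ifs with hs
    · rw [hs]; linarith
    · simpa using ha.1 s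
  · rw [sum_sub_basisVec, ha.2.2]
    push_cast
    ring

/-- If all coordinates of the end point of a path in the cuboid are extremal then, by connectivity
of the cyclic index set, they are all minimal or all maximal. -/
theorem eq_zero_or_eq_sides (hn : 1 ≤ n) {a c : Fin (n + 1) → ℤ} (h0 : 0 ≤ a)
    (hb : a ≤ sides m i) (hc : InCube m i a c) (hfree : ∀ t, ¬ (1 ≤ c t ∧ c t ≤ sides m i t)) :
    (a = 0 ∧ c = 0) ∨ (a = sides m i ∧ c = sides m i + 1) := by
  have h1 : ∀ t, 0 ≤ a t ∧ a t ≤ sides m i t ∧ a t ≤ c t ∧ c t ≤ a t + 1 := fun t =>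
    ⟨h0 t, hb t, hc.1 t, hc.2.1 t⟩
  by_cases h : ∃ t, 1 ≤ c t
  · right
    obtain ⟨t₀, ht₀⟩ := h
    have hall : ∀ t, 1 ≤ c t := by
      by_contra! hcon
      obtain ⟨s₀, hs₀⟩ := hcon
      have hv := (isVertex_shift_iff hn c).1 hc.2.2
      have := forall_of_add_one (p := fun t => c t < 1) hs₀ (fun t ht => by
        by_contra! h2
        have h3 := hv (t + 1)
        have h4 := hfree (t + 1)
        rw [add_sub_cancel_right] at h3
        exact h4 ⟨h2, by linarith⟩) t₀
      linarith
    have h2 : ∀ t, a t = sides m i t ∧ c t = sides m i t + 1 := fun t => by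
      have h3 := h1 t
      have h4 := hfree t
      have h5 := hall t
      omega
    exact ⟨funext fun t => (h2 t).1, funext fun t => (h2 t).2⟩
  · left
    push Not at h
    have h2 : ∀ t, a t = 0 ∧ c t = 0 := fun t => by
      have h3 := h1 t
      have h4 := h t
      omega
    exact ⟨funext fun t => (h2 t).1, funext fun t => (h2 t).2⟩

/-- The contracting homotopy: the part of a cycle that consists of the paths ending at `c` is a
boundary if `c` has a coordinate that is not extremal. -/
theorem exists_diff_eq (hn : 1 ≤ n) (hm : 3 ≤ m) (hd : IsAdmissible m d) (hi : IsVertex m i)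
    {l : ℕ} (x : Term m d i l)
    (hx : ∀ l', l' + 1 = l → ∀ a ∈ cuboidNet m i l', ∀ c, InCube m i a c →
      ∑ t, koszulSign k (a + basisVec t) t * tcoord m d i l x (a + basisVec t) c = 0)
    (hx' : ∀ a ∈ cuboidNet m i l, ∀ c, InCube m i a c →
      (∀ t, ¬ (1 ≤ c t ∧ c t ≤ sides m i t)) → tcoord m d i l x a c = 0) :
    ∃ y, diff m d i l y = x := by
  classical
  let τ : (Fin (n + 1) → ℤ) → Fin (n + 1) := fun c =>
    if h : ∃ t, 1 ≤ c t ∧ c t ≤ sides m i t then h.choose else 0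
  have hτ : ∀ c, (∃ t, 1 ≤ c t ∧ c t ≤ sides m i t) → 1 ≤ c (τ c) ∧ c (τ c) ≤ sides m i (τ c) := by
    intro c h
    simp only [τ, dif_pos h]
    exact h.choose_spec
  let Y : (Fin (n + 1) → ℤ) → (Fin (n + 1) → ℤ) → k := fun a c =>
    if (∃ t, 1 ≤ c t ∧ c t ≤ sides m i t) ∧ c (τ c) = a (τ c) then
      koszulSign k a (τ c) * tcoord m d i l x (a - basisVec (τ c)) c else 0
  obtain ⟨y, hy⟩ := exists_tcoord_eq hn hm hd hi (l + 1) Y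
  refine ⟨y, tcoord_ext hn hm hd hi fun a ha c hc => ?_⟩
  rw [tcoord_diff hn hm hd hi y ha hc]
  have hy0 : ∀ a c, ¬ (a ∈ cuboidNet m i (l + 1) ∧ InCube m i a c) →
      tcoord m d i (l + 1) y a c = 0 := fun a c h => tcoord_eq_zero hn hm hd hi y h
  have hx0 : ∀ a c, ¬ (a ∈ cuboidNet m i l ∧ InCube m i a c) →
      tcoord m d i l x a c = 0 := fun a c h => tcoord_eq_zero hn hm hd hi x h
  by_cases hfree : ∃ t, 1 ≤ c t ∧ c t ≤ sides m i t
  swap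
  · rw [hx' a ha c hc (not_exists.1 hfree)]
    refine Finset.sum_eq_zero fun t _ => ?_
    by_cases h : a + basisVec t ∈ cuboidNet m i (l + 1) ∧ InCube m i (a + basisVec t) c
    · rw [hy _ h.1 _ h.2]
      simp only [Y, if_neg (fun h : _ ∧ _ => hfree h.1), mul_zero]
    · rw [hy0 _ _ h, mul_zero]
  obtain ⟨h1, h2⟩ := hτ c hfree
  have hY : ∀ a, Y a c = if c (τ c) = a (τ c) then
      koszulSign k a (τ c) * tcoord m d i l x (a - basisVec (τ c)) c else 0 := by
    intro a
    simp only [Y, hfree, true_and]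
  set r := τ c
  have hac : a r ≤ c r := hc.1 r
  have hca : c r ≤ a r + 1 := hc.2.1 r
  by_cases har : c r = a r
  · -- the path does not use the direction `r`: the cycle condition at `a - e_r` is used
    obtain ⟨l', rfl⟩ : ∃ l', l = l' + 1 := by
      refine ⟨l - 1, ?_⟩
      have h3 := (mem_cuboidNet.1 ha).2.2
      have h4 := Finset.single_le_sum (fun t _ => (mem_cuboidNet.1 ha).1 t) (Finset.mem_univ r)
      omega
    obtain ⟨z, rfl⟩ : ∃ z, a = z + basisVec r := ⟨a - basisVec r, by abel⟩
    have hz : z ∈ cuboidNet m i l' := by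
      have := sub_mem_cuboidNet ha (har ▸ h1)
      rwa [add_sub_cancel_right] at this
    have hzr : c r = z r + 1 := by simpa [basisVec_apply] using har
    have hzc : InCube m i z c := by
      refine ⟨(le_add_basisVec z r).trans hc.1, fun s => ?_, hc.2.2⟩
      have := hc.2.1 s
      simp only [Pi.add_apply, Pi.one_apply, basisVec_apply] at this ⊢
      split_ifs at this with hs
      · subst hs; linarith
      · linarith
    have hcyc := hx l' rfl z hz c hzc
    have key : ∀ t, koszulSign k (z + basisVec r + basisVec t) t *
        tcoord m d i (l' + 1 + 1) y (z + basisVec r + basisVec t) c =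
        -koszulSign k (z + basisVec r) r * (koszulSign k (z + basisVec t) t *
          tcoord m d i (l' + 1) x (z + basisVec t) c) +
        if t = r then tcoord m d i (l' + 1) x (z + basisVec r) c else 0 := by
      intro t
      by_cases htr : t = r
      · rw [if_pos htr, htr, hy0, ← mul_assoc, neg_mul, koszulSign_mul_self]
        · ring
        · rintro ⟨-, h3⟩
          have h4 : (z + basisVec r + basisVec r) r ≤ c r := h3.1 r
          simp only [Pi.add_apply, basisVec_apply, if_true] at h4
          omega
      · rw [if_neg htr, add_zero]
        have hcr : c r = (z + basisVec r + basisVec t) r := by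
          simp [basisVec_apply, Ne.symm htr, hzr]
        have e : z + basisVec r + basisVec t - basisVec r = z + basisVec t := by abel
        have e' : z + basisVec t + basisVec r = z + basisVec r + basisVec t := by abel
        have hval : tcoord m d i (l' + 1 + 1) y (z + basisVec r + basisVec t) c =
            koszulSign k (z + basisVec r + basisVec t) r *
              tcoord m d i (l' + 1) x (z + basisVec t) c := by
          by_cases h : z + basisVec r + basisVec t ∈ cuboidNet m i (l' + 1 + 1) ∧
              InCube m i (z + basisVec r + basisVec t) c
          · rw [hy _ h.1 _ h.2, hY, if_pos hcr, e]
          · rw [hy0 _ _ h, hx0, mul_zero]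
            rintro ⟨h3, h4⟩
            have h5 : z r + 1 ≤ sides m i r := by rw [← hzr]; exact h2
            refine h ⟨?_, fun s => ?_, fun s => ?_, h4.2.2⟩
            · rw [← e']
              exact add_mem_cuboidNet h3 (by simpa [basisVec_apply, Ne.symm htr] using h5)
            · rw [← e']
              by_cases hs : s = r
              · subst hs
                rw [e', ← hcr]
              · simpa [basisVec_apply, hs] using h4.1 s
            · have h6 := h4.2.1 s
              have h7 := basisVec_nonneg r s
              simp only [Pi.add_apply, Pi.one_apply, Pi.zero_apply] at h6 h7 ⊢
              linarith
        rw [hval, ← mul_assoc, koszulSign_swap z (Ne.symm htr)]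
        ring
    rw [Finset.sum_congr rfl fun t _ => key t, Finset.sum_add_distrib, ← Finset.mul_sum, hcyc]
    simp
  · -- the path uses the direction `r`: only the summand `r` of the differential contributes
    have har' : c r = a r + 1 := by omega
    have hmem : a + basisVec r ∈ cuboidNet m i (l + 1) :=
      add_mem_cuboidNet ha (by rw [← har']; exact h2)
    have hcube : InCube m i (a + basisVec r) c := by
      refine ⟨fun s => ?_, hc.2.1.trans ?_, hc.2.2⟩
      · simp only [Pi.add_apply, basisVec_apply]
        split_ifs with hs
        · rw [hs, har']
        · simpa using hc.1 s
      · exact add_le_add_left (le_add_basisVec a r) 1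
    rw [Finset.sum_eq_single r]
    · rw [hy _ hmem _ hcube, hY, if_pos (by simp [basisVec_apply, har']), add_sub_cancel_right,
        ← mul_assoc, koszulSign_mul_self, one_mul]
    · intro t _ htr
      by_cases h : a + basisVec t ∈ cuboidNet m i (l + 1) ∧ InCube m i (a + basisVec t) c
      · rw [hy _ h.1 _ h.2, hY, if_neg, mul_zero]
        simpa [basisVec_apply, Ne.symm htr] using har
      · rw [hy0 _ _ h, mul_zero]
    · exact fun h => absurd (Finset.mem_univ _) h

/-- A boundary has no component along trivial paths. -/
theorem tcoord_diff_self (hn : 1 ≤ n) (hm : 3 ≤ m) (hd : IsAdmissible m d) (hi : IsVertex m i)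
    {l : ℕ} (y : Term m d i (l + 1)) {a : Fin (n + 1) → ℤ} (ha : a ∈ cuboidNet m i l) :
    tcoord m d i l (diff m d i l y) a a = 0 := by
  rw [tcoord_diff hn hm hd hi y ha (inCube_self (isPoint_of_mem hn ha).2)]
  refine Finset.sum_eq_zero fun t _ => ?_
  rw [tcoord_eq_zero hn hm hd hi y, mul_zero]
  rintro ⟨-, h⟩
  have : (a + basisVec t) t ≤ a t := h.1 t
  simp [basisVec_apply] at this

theorem diff_diff (hn : 1 ≤ n) (hm : 3 ≤ m) (hd : IsAdmissible m d) (hi : IsVertex m i)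
    {l : ℕ} (y : Term m d i (l + 2)) : diff m d i l (diff m d i (l + 1) y) = 0 := by
  refine tcoord_ext hn hm hd hi fun a ha c hc => ?_
  have h0 : tcoord m d i l (0 : Term m d i l) a c = 0 := by
    rw [tcoord, map_zero, map_zero, Finsupp.zero_apply]
  rw [tcoord_diff hn hm hd hi _ ha hc, h0]
  have h1 : ∀ t, koszulSign k (a + basisVec t) t *
      tcoord m d i (l + 1) (diff m d i (l + 1) y) (a + basisVec t) c =
      ∑ s, if s = t then 0 else koszulSign k (a + basisVec t) t *
        (koszulSign k (a + basisVec t + basisVec s) s *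
          tcoord m d i (l + 2) y (a + basisVec t + basisVec s) c) := by
    intro t
    have hzero : tcoord m d i (l + 2) y (a + basisVec t + basisVec t) c = 0 := by
      refine tcoord_eq_zero hn hm hd hi y fun h => ?_
      have h1 : (a + basisVec t + basisVec t) t ≤ c t := h.2.1 t
      have h2 : c t ≤ a t + 1 := hc.2.1 t
      simp [basisVec_apply] at h1
      omega
    by_cases h : a + basisVec t ∈ cuboidNet m i (l + 1) ∧ InCube m i (a + basisVec t) c
    · rw [tcoord_diff hn hm hd hi y h.1 h.2, Finset.mul_sum]
      refine Finset.sum_congr rfl fun s _ => ?_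
      split_ifs with hs
      · rw [hs, hzero, mul_zero, mul_zero]
      · rfl
    · rw [tcoord_eq_zero hn hm hd hi _ h, mul_zero]
      refine (Finset.sum_eq_zero fun s _ => ?_).symm
      split_ifs with hs
      · rfl
      rw [tcoord_eq_zero hn hm hd hi y, mul_zero, mul_zero]
      rintro ⟨h3, h4⟩
      have h5 : a + basisVec t ≤ a + basisVec t + basisVec s := le_add_basisVec _ _
      refine h ⟨?_, h5.trans h4.1, ?_, h4.2.2⟩
      · rw [mem_cuboidNet] at ha h3 ⊢
        refine ⟨ha.1.trans (le_add_basisVec a t), h5.trans h3.2.1, ?_⟩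
        rw [sum_add_basisVec, ha.2.2]
        push_cast
        ring
      · exact hc.2.1.trans (add_le_add_left (le_add_basisVec a t) 1)
  rw [Finset.sum_congr rfl fun t _ => h1 t, ← Fintype.sum_prod_type']
  -- the summands for `(t, s)` and `(s, t)` cancel
  refine Finset.sum_involution (fun p _ => p.swap) ?_ ?_ (fun _ _ => Finset.mem_univ _)
    (fun _ _ => Prod.swap_swap _)
  · rintro ⟨t, s⟩ -
    simp only [Prod.swap]
    by_cases hst : s = t
    · simp [hst]
    · rw [if_neg hst, if_neg (Ne.symm hst), add_right_comm a (basisVec s) (basisVec t)]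
      linear_combination tcoord m d i (l + 2) y (a + basisVec t + basisVec s) c *
        koszulSign_anticomm (k := k) a hst
  · rintro ⟨t, s⟩ - hne heq
    refine hne ?_
    rw [Prod.swap_prod_mk, Prod.mk.injEq] at heq
    rw [if_pos heq.1]

end Exactness

/-! ### Superfluous submodules and uniqueness of minimal resolutions -/

section Homological

/-- A form of Nakayama's lemma: if all sufficiently long products of elements of `A` annihilate `M`
then a submodule contained in `A • M` is superfluous. -/
theorem isSuperfluous_of_nilpotent {R M : Type*} [Ring R] [AddCommGroup M] [Module R M]
    (A : Set R) (N : Submodule R M) (q : ℕ)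
    (hq : ∀ w : List R, w.length = q → (∀ r ∈ w, r ∈ A) → ∀ x : M, w.prod • x = 0)
    (hN : ∀ x ∈ N, x ∈ AddSubmonoid.closure {y : M | ∃ r ∈ A, ∃ z : M, y = r • z}) :
    IsSuperfluous N := by
  intro L hL
  -- descending induction on the length of the product
  have key : ∀ p ≤ q, ∀ w : List R, w.length = q - p → (∀ r ∈ w, r ∈ A) →
      ∀ x : M, w.prod • x ∈ L := by
    intro p
    induction p with
    | zero =>
      intro _ w hw hA x
      rw [hq w (by omega) hA x]
      exact L.zero_mem
    | succ p ih =>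
      intro hp w hw hA x
      have hx : x ∈ N ⊔ L := hL ▸ Submodule.mem_top
      obtain ⟨y, hy, z, hz, rfl⟩ := Submodule.mem_sup.1 hx
      rw [smul_add]
      refine L.add_mem ?_ (L.smul_mem _ hz)
      have hy' := hN y hy
      clear hx hy
      induction hy' using AddSubmonoid.closure_induction with
      | mem y hy =>
        obtain ⟨r, hr, v, rfl⟩ := hy
        have := ih (by omega) (w ++ [r]) (by simp; omega) (by
          intro r' hr'
          rcases List.mem_append.1 hr' with h | h
          · exact hA r' h
          · rw [List.mem_singleton.1 h]; exact hr) v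
        rwa [List.prod_append, List.prod_singleton, mul_smul] at this
      | zero => rw [smul_zero]; exact L.zero_mem
      | add y₁ y₂ _ _ h₁ h₂ => rw [smul_add]; exact L.add_mem h₁ h₂
  refine top_le_iff.1 fun x _ => ?_
  simpa using key q le_rfl [] (by simp) (by simp) x

/-- Uniqueness of projective covers, relative to an injective map between the targets. -/
theorem exists_bijective_lift {R A B A' B' : Type*} [Ring R] [AddCommGroup A] [Module R A]
    [AddCommGroup B] [Module R B] [AddCommGroup A'] [Module R A'] [AddCommGroup B'] [Module R B']
    (α : A →ₗ[R] B) (α' : A' →ₗ[R] B') (ψ : B →ₗ[R] B') (hψ : Function.Injective ψ)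
    (hr : (LinearMap.range α).map ψ = LinearMap.range α') (hA : Module.Projective R A)
    (hA' : Module.Projective R A') (hα : IsSuperfluous (LinearMap.ker α))
    (hα' : IsSuperfluous (LinearMap.ker α')) :
    ∃ φ : A →ₗ[R] A', Function.Bijective φ ∧ α' ∘ₗ φ = ψ ∘ₗ α := by
  have hmem : ∀ x, (ψ ∘ₗ α) x ∈ LinearMap.range α' := fun x => by
    rw [← hr]
    exact ⟨α x, ⟨x, rfl⟩, rfl⟩
  obtain ⟨φ, hφ⟩ := Module.projective_lifting_property α'.rangeRestrict
    ((ψ ∘ₗ α).codRestrict _ hmem) α'.surjective_rangeRestrict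
  have hcomm : α' ∘ₗ φ = ψ ∘ₗ α := LinearMap.ext fun x =>
    congrArg Subtype.val (LinearMap.congr_fun hφ x)
  have hsurj : LinearMap.range φ = ⊤ := by
    refine hα' _ (top_le_iff.1 fun y _ => ?_)
    have hy : α' y ∈ (LinearMap.range α).map ψ := hr ▸ ⟨y, rfl⟩
    obtain ⟨_, ⟨x, rfl⟩, hx⟩ := hy
    have hx' : α' (φ x) = α' y := (LinearMap.congr_fun hcomm x).trans hx
    refine Submodule.mem_sup.2 ⟨y - φ x, ?_, φ x, ⟨x, rfl⟩, sub_add_cancel _ _⟩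
    rw [LinearMap.mem_ker, map_sub, hx', sub_self]
  obtain ⟨s, hs⟩ := Module.projective_lifting_property φ LinearMap.id
    (LinearMap.range_eq_top.1 hsurj)
  have hs' : ∀ y, φ (s y) = y := fun y => LinearMap.congr_fun hs y
  have hs_top : LinearMap.range s = ⊤ := by
    refine hα _ (top_le_iff.1 fun x _ => ?_)
    refine Submodule.mem_sup.2 ⟨x - s (φ x), ?_, s (φ x), ⟨φ x, rfl⟩, sub_add_cancel _ _⟩
    rw [LinearMap.mem_ker]
    apply hψ
    have h1 := LinearMap.congr_fun hcomm (x - s (φ x))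
    simp only [LinearMap.comp_apply] at h1
    rw [← h1, map_sub φ, hs', sub_self, map_zero, map_zero]
  refine ⟨φ, ⟨?_, LinearMap.range_eq_top.1 hsurj⟩, hcomm⟩
  intro x y hxy
  obtain ⟨x, rfl⟩ := LinearMap.range_eq_top.1 hs_top x
  obtain ⟨y, rfl⟩ := LinearMap.range_eq_top.1 hs_top y
  rw [hs', hs'] at hxy
  rw [hxy]

theorem map_ker_of_bijective {R A B A' B' : Type*} [Ring R] [AddCommGroup A] [Module R A]
    [AddCommGroup B] [Module R B] [AddCommGroup A'] [Module R A'] [AddCommGroup B'] [Module R B']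
    {α : A →ₗ[R] B} {α' : A' →ₗ[R] B'} {ψ : B →ₗ[R] B'} (hψ : Function.Injective ψ)
    {φ : A →ₗ[R] A'} (hφ : Function.Surjective φ) (h : α' ∘ₗ φ = ψ ∘ₗ α) :
    (LinearMap.ker α).map φ = LinearMap.ker α' := by
  have h' : ∀ x, α' (φ x) = ψ (α x) := fun x => LinearMap.congr_fun h x
  ext y
  constructor
  · rintro ⟨x, hx, rfl⟩
    rw [LinearMap.mem_ker, h', LinearMap.mem_ker.1 hx, map_zero]
  · intro hy
    obtain ⟨x, rfl⟩ := hφ y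
    refine ⟨x, ?_, rfl⟩
    apply hψ
    rw [← h', LinearMap.mem_ker.1 hy, map_zero]

theorem nonempty_ker_equiv {R A B A' B' : Type*} [Ring R] [AddCommGroup A] [Module R A]
    [AddCommGroup B] [Module R B] [AddCommGroup A'] [Module R A'] [AddCommGroup B'] [Module R B']
    {α : A →ₗ[R] B} {α' : A' →ₗ[R] B'} {ψ : B →ₗ[R] B'} (hψ : Function.Injective ψ)
    {φ : A →ₗ[R] A'} (hφ : Function.Bijective φ) (h : α' ∘ₗ φ = ψ ∘ₗ α) :
    Nonempty (LinearMap.ker α ≃ₗ[R] LinearMap.ker α') :=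
  ⟨(Submodule.equivMapOfInjective φ hφ.1 _).trans
    (LinearEquiv.ofEq _ _ (map_ker_of_bijective hψ hφ.2 h))⟩

/-- Two beginnings of minimal projective resolutions of the same module are isomorphic. -/
theorem IsMinimalResolutionUpTo.exists_iso {R S : Type*} [Ring R] [AddCommGroup S] [Module R S]
    {q : ℕ} {P : ℕ → Type*} [∀ l, AddCommGroup (P l)] [∀ l, Module R (P l)]
    {P' : ℕ → Type*} [∀ l, AddCommGroup (P' l)] [∀ l, Module R (P' l)]
    {ε : P 0 →ₗ[R] S} {f : ∀ l, P (l + 1) →ₗ[R] P l}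
    {ε' : P' 0 →ₗ[R] S} {f' : ∀ l, P' (l + 1) →ₗ[R] P' l}
    (h : IsMinimalResolutionUpTo q ε f) (h' : IsMinimalResolutionUpTo q ε' f') :
    ∃ φ : ∀ l, P l →ₗ[R] P' l, (∀ l ≤ q, Function.Bijective (φ l)) ∧ ε' ∘ₗ φ 0 = ε ∧
      ∀ l < q, f' l ∘ₗ φ (l + 1) = φ l ∘ₗ f l := by
  obtain ⟨φ₀, hφ₀, hε⟩ := exists_bijective_lift ε ε' LinearMap.id Function.injective_id
    (by rw [Submodule.map_id, LinearMap.range_eq_top.2 h.surjective,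
      LinearMap.range_eq_top.2 h'.surjective])
    (h.projective 0 (Nat.zero_le q)) (h'.projective 0 (Nat.zero_le q)) h.minimal_zero
    h'.minimal_zero
  -- the property that is propagated from one degree to the next
  let Good : ∀ l, (P l →ₗ[R] P' l) → Prop := fun l φ =>
    l ≤ q → Function.Bijective φ ∧
      (l < q → (LinearMap.range (f l)).map φ = LinearMap.range (f' l))
  have good₀ : Good 0 φ₀ := fun _ => ⟨hφ₀, fun hq => by
    rw [h.exact_zero hq, h'.exact_zero hq]
    exact map_ker_of_bijective Function.injective_id hφ₀.2 hε⟩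
  have next : ∀ l (φ : {φ : P l →ₗ[R] P' l // Good l φ}),
      ∃ φ' : P (l + 1) →ₗ[R] P' (l + 1), Good (l + 1) φ' ∧
        (l < q → f' l ∘ₗ φ' = φ.1 ∘ₗ f l) := by
    rintro l ⟨φ, hφ⟩
    by_cases hl : l < q
    · obtain ⟨hb, hr⟩ := hφ hl.le
      obtain ⟨φ', hφ', hc⟩ := exists_bijective_lift (f l) (f' l) φ hb.1 (hr hl)
        (h.projective _ hl) (h'.projective _ hl) (h.minimal_succ l hl) (h'.minimal_succ l hl)
      refine ⟨φ', fun _ => ⟨hφ', fun hl' => ?_⟩, fun _ => hc⟩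
      rw [h.exact_succ l hl', h'.exact_succ l hl']
      exact map_ker_of_bijective hb.1 hφ'.2 hc
    · exact ⟨0, fun hl' => absurd hl' hl, fun hl' => absurd hl' hl⟩
  choose F hF hFc using next
  let Φ : ∀ l, {φ : P l →ₗ[R] P' l // Good l φ} := fun l =>
    Nat.rec ⟨φ₀, good₀⟩ (fun l φ => ⟨F l φ, hF l φ⟩) l
  exact ⟨fun l => (Φ l).1, fun l hl => ((Φ l).2 hl).1, hε, fun l hl => hFc l (Φ l) hl⟩

end Homological

/-! ### Radicals and superfluous kernels -/

section Radical

variable {k : Type u} [Field k] {n m : ℕ} {d : Coeff k n} {i : Fin n → ℤ}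

theorem projective_proj (j : Fin n → ℤ) :
    Module.Projective (StableAlg m d) (Proj m d j) :=
  Module.Projective.of_split (Proj m d j).subtype
    (LinearMap.toSpanSingleton (StableAlg m d) _ (projGen m d j))
    (LinearMap.ext fun y => Subtype.ext (mul_idem_of_mem y.2))

theorem projective_term (l : ℕ) : Module.Projective (StableAlg m d) (Term m d i l) := by
  have : ∀ a : cuboidNet m i l, Module.Projective (StableAlg m d) (Proj m d (shift i a.1)) :=
    fun a => projective_proj _
  infer_instance

theorem arrow_mem_proj (t : Fin (n + 1)) (j : Fin n → ℤ) : arrow m d t j ∈ Proj m d j := by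
  rw [← arrow_mul_idem_self]
  exact Submodule.smul_mem _ _ (Submodule.subset_span rfl)

/-- Paths of positive length lie in the radical. -/
theorem path_mem_map_radProj (hn : 1 ≤ n) (hm : 3 ≤ m) (hd : IsAdmissible m d)
    {a c : Fin (n + 1) → ℤ} (ha : IsPoint m i a) (hc : InCube m i a c) (hne : c ≠ a) :
    path m d i a c ∈ (radProj m d (shift i a)).map (Proj m d (shift i a)).subtype := by
  have harrow : ∀ t, arrow m d t (shift i a) ∈
      (radProj m d (shift i a)).map (Proj m d (shift i a)).subtype := fun t =>
    ⟨⟨_, arrow_mem_proj t _⟩, Submodule.subset_span ⟨t, rfl⟩, rfl⟩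
  refine InCube.induction hn hm ha.2 (P := fun c => c ≠ a → path m d i a c ∈
    (radProj m d (shift i a)).map (Proj m d (shift i a)).subtype) ?_ ?_ hc hne
  · exact fun h => absurd rfl h
  · intro c t hc hct ih _
    rw [← scaledArrow_mul_path hn hm hd ha hc]
    by_cases hca : c = a
    · subst hca
      rw [path_self ha.2, scaledArrow, smul_mul_assoc, arrow_mul_idem_self, ← smul_one_mul]
      exact Submodule.smul_mem _ _ (harrow t)
    · exact Submodule.smul_mem _ _ (ih hca)

/-- The radical of a projective consists of the combinations of paths of positive length. -/
theorem mem_radProj_iff (hn : 1 ≤ n) (hm : 3 ≤ m) (hd : IsAdmissible m d) (hi : IsVertex m i)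
    {a : Fin (n + 1) → ℤ} (ha : IsPoint m i a) {j : Fin n → ℤ} (hj : shift i a = j)
    (y : Proj m d j) : y ∈ radProj m d j ↔ coord m d i a y a = 0 := by
  subst hj
  constructor
  · intro hy
    induction hy using Submodule.closure_induction with
    | zero => simp
    | add y z _ _ hy hz =>
      rw [Submodule.coe_add, map_add, Finsupp.add_apply, hy, hz, add_zero]
    | smul_mem z y hy =>
      obtain ⟨t, ht⟩ := hy
      rw [Submodule.coe_smul, ht, smul_eq_mul]
      by_cases hat : IsVertex m (shift i (a + basisVec t))
      · have hat' : IsPoint m i (a + basisVec t) := ⟨ha.1.trans (le_add_basisVec a t), hat⟩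
        have h1 : arrow m d t (shift i a) =
            idem m d (shift i (a + basisVec t)) * arrow m d t (shift i a) := by
          rw [← step_shift, idem_mul_arrow_self]
        have hmem : z * idem m d (shift i (a + basisVec t)) ∈
            Proj m d (shift i (a + basisVec t)) :=
          Submodule.smul_mem _ _ (Submodule.subset_span rfl)
        rw [h1, arrow_eq_smul_scaledArrow hn hd ha.1, ← mul_assoc, mul_smul_comm, map_smul,
          Finsupp.smul_apply, coord_mul_scaledArrow hn hm hd hi ha hat' (inCube_self ha.2) hmem,
          coord_eq_zero hn hm hd hi hat' hmem, smul_zero]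
        intro h
        have : (a + basisVec t) t ≤ a t := h.1 t
        simp [basisVec_apply] at this
      · rw [arrow_eq_zero, mul_zero, map_zero, Finsupp.zero_apply]
        rw [step_shift]
        exact fun h => hat h.2
  · intro hy
    have h1 : (y : StableAlg m d) ∈
        (radProj m d (shift i a)).map (Proj m d (shift i a)).subtype := by
      rw [eq_sum_coord hn hm hd hi ha y.2]
      refine Submodule.sum_mem _ fun c hc => ?_
      by_cases hca : c = a
      · rw [hca, hy, zero_smul]
        exact zero_mem _
      · rw [← smul_one_mul]
        exact Submodule.smul_mem _ _
          (path_mem_map_radProj hn hm hd ha (mem_cubePoints.1 hc) hca)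
    obtain ⟨z, hz, hzy⟩ := h1
    rwa [← Subtype.ext hzy]

/-- A product of `q` arrows maps a path to combinations of paths that are longer by `q`. -/
theorem prod_mul_path_mem (hn : 1 ≤ n) (hm : 3 ≤ m) (hd : IsAdmissible m d)
    {a c : Fin (n + 1) → ℤ} (ha : IsPoint m i a) (w : List (StableAlg m d))
    (hw : ∀ r ∈ w, ∃ t j, r = arrow m d t j) :
    ∃ (r : k) (c' : Fin (n + 1) → ℤ), ∑ t, c' t = ∑ t, c t + w.length ∧
      w.prod * path m d i a c = r • path m d i a c' := by
  induction w with
  | nil => exact ⟨1, c, by simp, by simp⟩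
  | cons x w ih =>
    obtain ⟨r, c', hc', h⟩ := ih fun y hy => hw y (List.mem_cons_of_mem x hy)
    obtain ⟨t, j, rfl⟩ := hw x List.mem_cons_self
    have hsum : ∑ s, (c' + basisVec t) s = ∑ s, c s + (w.length + 1 : ℕ) := by
      rw [sum_add_basisVec, hc']
      push_cast
      ring
    rw [List.prod_cons, mul_assoc, h, mul_smul_comm, List.length_cons]
    by_cases hcube : InCube m i a c'
    · by_cases hj : j = shift i c'
      · refine ⟨r * lam m d i t c', c' + basisVec t, hsum, ?_⟩
        rw [hj, arrow_mul_path hn hm hd ha hcube, mul_smul]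
      · refine ⟨0, c' + basisVec t, hsum, ?_⟩
        rw [arrow_mul_path_of_ne hn hm hd ha hcube t hj, smul_zero, zero_smul]
    · refine ⟨0, c' + basisVec t, hsum, ?_⟩
      rw [path_eq_zero hcube, mul_zero, smul_zero, zero_smul]

theorem prod_mul_path_eq_zero (hn : 1 ≤ n) (hm : 3 ≤ m) (hd : IsAdmissible m d)
    {a c : Fin (n + 1) → ℤ} (ha : IsPoint m i a) (hc : InCube m i a c) {w : List (StableAlg m d)}
    (hw : ∀ r ∈ w, ∃ t j, r = arrow m d t j) (hlen : w.length = n + 2) :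
    w.prod * path m d i a c = 0 := by
  obtain ⟨r, c', hc', h⟩ := prod_mul_path_mem (c := c) hn hm hd ha w hw
  rw [h, path_eq_zero, smul_zero]
  intro hcube
  have h1 : ∑ t, c' t ≤ ∑ t, (a + 1) t := Finset.sum_le_sum fun t _ => hcube.2.1 t
  have h2 : ∑ t, a t ≤ ∑ t, c t := Finset.sum_le_sum fun t _ => hc.1 t
  rw [hc', hlen] at h1
  simp only [Pi.add_apply, Pi.one_apply, Finset.sum_add_distrib, Finset.sum_const,
    Finset.card_univ, Fintype.card_fin, nsmul_eq_mul, mul_one] at h1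
  push_cast at h1
  linarith

/-- A submodule of a term whose elements have no component along trivial paths is superfluous. -/
theorem isSuperfluous_of_tcoord_self (hn : 1 ≤ n) (hm : 3 ≤ m) (hd : IsAdmissible m d)
    (hi : IsVertex m i) {l : ℕ} (N : Submodule (StableAlg m d) (Term m d i l))
    (hN : ∀ x ∈ N, ∀ a ∈ cuboidNet m i l, tcoord m d i l x a a = 0) : IsSuperfluous N := by
  refine isSuperfluous_of_nilpotent {r | ∃ t j, r = arrow m d t j} N (n + 2) ?_ ?_
  · intro w hlen hw x
    rw [eq_sum_tcoord hn hm hd hi x, Finset.smul_sum]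
    refine Finset.sum_eq_zero fun a ha => ?_
    rw [Finset.smul_sum]
    refine Finset.sum_eq_zero fun c hc => ?_
    rw [smul_smul, mul_smul_comm, prod_mul_path_eq_zero hn hm hd (isPoint_of_mem hn ha)
      (mem_cubePoints.1 hc) hw hlen, smul_zero, zero_smul]
  · intro x hx
    rw [eq_sum_tcoord hn hm hd hi x]
    refine AddSubmonoid.sum_mem _ fun a ha => AddSubmonoid.sum_mem _ fun c hc => ?_
    rw [mem_cubePoints] at hc
    have hap := isPoint_of_mem hn ha
    by_cases hca : c = a
    · rw [hca, hN x hx a ha, zero_smul, zero_smul]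
      exact AddSubmonoid.zero_mem _
    · obtain ⟨s, hs⟩ := hc.exists_sub hn hm hap.2 hca
      refine AddSubmonoid.subset_closure ⟨arrow m d s (shift i (c - basisVec s)), ⟨_, _, rfl⟩,
        ((tcoord m d i l x a c * (lam m d i s (c - basisVec s))⁻¹) •
          path m d i a (c - basisVec s)) • gen m d i l a, ?_⟩
      have h1 := scaledArrow_mul_path hn hm hd hap hs s
      rw [sub_add_cancel] at h1
      rw [← h1, scaledArrow, smul_smul, mul_smul_comm, smul_mul_assoc, smul_smul]

end Radical

/-! ### Homogeneity -/

section Homogeneity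

variable {k : Type u} [Field k] {n m : ℕ} {d : Coeff k n} {i : Fin n → ℤ}

theorem mul_arrow_mem_homog (p : ℕ) {y : StableAlg m d} (hy : y ∈ homog m d p)
    (t : Fin (n + 1)) (j : Fin n → ℤ) : y * arrow m d t j ∈ homog m d (p + 1) := by
  induction p generalizing y with
  | zero =>
    have harrow : arrow m d t j ∈ homog m d 1 := by
      rw [← arrow_mul_idem_self]
      exact Submodule.mul_mem_mul (Submodule.subset_span ⟨(t, j), rfl⟩)
        (Submodule.subset_span ⟨j, rfl⟩)
    rw [homog] at hy
    induction hy using Submodule.span_induction with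
    | mem y hy =>
      obtain ⟨j', rfl⟩ := hy
      by_cases h : j' = step t j
      · rw [h, idem_mul_arrow_self]
        exact harrow
      · rw [idem_mul_arrow_of_ne t h]
        exact zero_mem _
    | zero => rw [zero_mul]; exact zero_mem _
    | add x y _ _ hx hy => rw [add_mul]; exact add_mem hx hy
    | smul r x _ hx => rw [smul_mul_assoc]; exact Submodule.smul_mem _ _ hx
  | succ p ih =>
    rw [homog] at hy
    induction hy using Submodule.mul_induction_on' with
    | mem_mul_mem x hx y hy =>
      rw [mul_assoc]
      exact Submodule.mul_mem_mul hx (ih hy)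
    | add x _ y _ hx hy => rw [add_mul]; exact add_mem hx hy

theorem diff_mem_homog {l p : ℕ} (x : Term m d i (l + 1))
    (hx : ∀ a, (x a : StableAlg m d) ∈ homog m d p) (a : cuboidNet m i l) :
    (diff m d i l x a : StableAlg m d) ∈ homog m d (p + 1) := by
  have h := comp_diff x a.2
  rw [comp_apply a.2] at h
  rw [show diff m d i l x a = diff m d i l x ⟨a.1, a.2⟩ from rfl, h]
  refine Submodule.sum_mem _ fun t _ => Submodule.smul_mem _ _ ?_
  rw [scaledArrow, mul_smul_comm]
  refine Submodule.smul_mem _ _ (mul_arrow_mem_homog p ?_ t _)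
  by_cases hat : a.1 + basisVec t ∈ cuboidNet m i (l + 1)
  · rw [comp_apply hat]
    exact hx _
  · rw [comp_of_notMem hat]
    exact zero_mem _

end Homogeneity

/-! ### The kernels -/

section Kernels

variable {k : Type u} [Field k] {n m : ℕ} {d : Coeff k n} {i : Fin n → ℤ}

theorem sides_nonneg (hn : 1 ≤ n) (hi : IsVertex m i) : 0 ≤ sides m i :=
  (isVertex_iff_sides_nonneg hn i).1 hi

theorem cuboidNet_zero (hn : 1 ≤ n) (hi : IsVertex m i) : cuboidNet m i 0 = {0} := by
  ext a
  rw [mem_cuboidNet, Finset.mem_singleton]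
  constructor
  · rintro ⟨h0, -, h⟩
    exact funext fun t => (Finset.sum_eq_zero_iff_of_nonneg fun s _ => h0 s).1 (by simpa using h) t
      (Finset.mem_univ t)
  · rintro rfl
    exact ⟨le_rfl, sides_nonneg hn hi, by simp⟩

theorem cuboidNet_last (hn : 1 ≤ n) (hi : IsVertex m i) {l : ℕ} (hl : l + 1 = m) :
    cuboidNet m i l = {sides m i} := by
  have hsum := sum_sides m i
  ext a
  rw [mem_cuboidNet, Finset.mem_singleton]
  constructor
  · rintro ⟨-, hb, h⟩
    have h1 : ∑ t, (sides m i t - a t) = 0 := by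
      rw [Finset.sum_sub_distrib, hsum, h, ← hl]
      push_cast
      ring
    refine funext fun t => ?_
    have := (Finset.sum_eq_zero_iff_of_nonneg fun s _ => sub_nonneg.2 (hb s)).1 h1 t
      (Finset.mem_univ t)
    linarith
  · rintro rfl
    refine ⟨sides_nonneg hn hi, le_rfl, ?_⟩
    rw [hsum, ← hl]
    push_cast
    ring

theorem sides_eq_level {l : ℕ} (h : sides m i ∈ cuboidNet m i l) : l + 1 = m := by
  have h1 := (mem_cuboidNet.1 h).2.2
  rw [sum_sides] at h1
  omega

theorem shift_add_one (i : Fin n → ℤ) (c : Fin (n + 1) → ℤ) : shift i (c + 1) = shift i c := by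
  funext s
  simp only [shift, Pi.add_apply, Pi.one_apply]
  ring

theorem isPoint_sides (hn : 1 ≤ n) (hi : IsVertex m i) : IsPoint m i (sides m i) :=
  isPoint_of_le_sides hn (sides_nonneg hn hi) le_rfl

/-- The augmentation onto the simple module. -/
noncomputable def augmentation (m : ℕ) (d : Coeff k n) (i : Fin n → ℤ) :
    Term m d i 0 →ₗ[StableAlg m d] Simple m d i :=
  termLift m d i 0 fun _ => Submodule.Quotient.mk (projGen m d i)

theorem smul_projGen {j : Fin n → ℤ} (y : Proj m d j) : (y : StableAlg m d) • projGen m d j = y :=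
  Subtype.ext (mul_idem_of_mem y.2)

theorem augmentation_gen (hn : 1 ≤ n) (hi : IsVertex m i) :
    augmentation m d i (gen m d i 0 0) = Submodule.Quotient.mk (projGen m d i) := by
  rw [augmentation, termLift_gen _ (by rw [cuboidNet_zero hn hi]; simp), shift_zero,
    ← Submodule.Quotient.mk_smul]
  congr 1
  exact smul_projGen (projGen m d i)

theorem augmentation_surjective (hn : 1 ≤ n) (hi : IsVertex m i) :
    Function.Surjective (augmentation m d i) := by
  intro z
  obtain ⟨y, rfl⟩ := Submodule.Quotient.mk_surjective _ z
  refine ⟨(y : StableAlg m d) • gen m d i 0 0, ?_⟩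
  rw [map_smul, augmentation_gen hn hi, ← Submodule.Quotient.mk_smul, smul_projGen]

theorem mem_ker_augmentation_iff (hn : 1 ≤ n) (hm : 3 ≤ m) (hd : IsAdmissible m d)
    (hi : IsVertex m i) (x : Term m d i 0) :
    x ∈ LinearMap.ker (augmentation m d i) ↔ tcoord m d i 0 x 0 0 = 0 := by
  have h0 : IsPoint m i 0 := isPoint_of_le_sides hn le_rfl (sides_nonneg hn hi)
  have h2 : ∑ a ∈ cuboidNet m i 0, comp m d i 0 a x •
      (Submodule.Quotient.mk (projGen m d i) : Simple m d i) =
      comp m d i 0 0 x • Submodule.Quotient.mk (projGen m d i) := by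
    refine Finset.sum_eq_single 0 (fun a ha hne => absurd ha ?_) fun h => absurd ?_ h
    · rwa [cuboidNet_zero hn hi, Finset.mem_singleton]
    · rw [cuboidNet_zero hn hi, Finset.mem_singleton]
  rw [LinearMap.mem_ker, augmentation, termLift_apply, h2,
    ← Submodule.Quotient.mk_smul, Submodule.Quotient.mk_eq_zero,
    mem_radProj_iff hn hm hd hi h0 (shift_zero i), tcoord]
  have h1 : ((comp m d i 0 0 x • projGen m d i : Proj m d i) : StableAlg m d) =
      comp m d i 0 0 x := by
    have := comp_mem (0 : Fin (n + 1) → ℤ) x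
    rw [shift_zero] at this
    exact mul_idem_of_mem this
  rw [h1]

theorem range_diff_eq_ker_augmentation (hn : 1 ≤ n) (hm : 3 ≤ m) (hd : IsAdmissible m d)
    (hi : IsVertex m i) :
    LinearMap.range (diff m d i 0) = LinearMap.ker (augmentation m d i) := by
  have hmem : (0 : Fin (n + 1) → ℤ) ∈ cuboidNet m i 0 := by rw [cuboidNet_zero hn hi]; simp
  ext x
  rw [mem_ker_augmentation_iff hn hm hd hi]
  constructor
  · rintro ⟨y, rfl⟩
    exact tcoord_diff_self hn hm hd hi y hmem
  · intro hx
    refine exists_diff_eq hn hm hd hi x (fun l' h => absurd h (Nat.succ_ne_zero l')) ?_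
    intro a ha c hc hfree
    obtain ⟨rfl, rfl⟩ | ⟨rfl, -⟩ := eq_zero_or_eq_sides hn (mem_cuboidNet.1 ha).1
      (mem_cuboidNet.1 ha).2.1 hc hfree
    · exact hx
    · have := sides_eq_level ha
      omega

theorem range_diff_eq_ker (hn : 1 ≤ n) (hm : 3 ≤ m) (hd : IsAdmissible m d)
    (hi : IsVertex m i) {l : ℕ} (hl : l + 2 < m) :
    LinearMap.range (diff m d i (l + 1)) = LinearMap.ker (diff m d i l) := by
  ext x
  constructor
  · rintro ⟨y, rfl⟩
    exact diff_diff hn hm hd hi y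
  · intro hx
    refine exists_diff_eq hn hm hd hi x (fun l' h a ha c hc => ?_) ?_
    · obtain rfl : l' = l := by omega
      rw [← tcoord_diff hn hm hd hi x ha hc, LinearMap.mem_ker.1 hx, tcoord, map_zero, map_zero,
        Finsupp.zero_apply]
    · intro a ha c hc hfree
      obtain ⟨rfl, rfl⟩ | ⟨rfl, -⟩ := eq_zero_or_eq_sides hn (mem_cuboidNet.1 ha).1
        (mem_cuboidNet.1 ha).2.1 hc hfree
      · have := (mem_cuboidNet.1 ha).2.2
        simp at this
        omega
      · have := sides_eq_level ha
        omega

theorem range_diff_eq_span (l : ℕ) :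
    LinearMap.range (diff m d i l) = Submodule.span (StableAlg m d)
      (theta m d i l (zeta m d i l) '' (cuboidNet m i (l + 1) : Set (Fin (n + 1) → ℤ))) := by
  apply le_antisymm
  · rintro _ ⟨x, rfl⟩
    rw [diff, termLift_apply]
    exact Submodule.sum_mem _ fun a ha => Submodule.smul_mem _ _
      (Submodule.subset_span ⟨a, ha, rfl⟩)
  · rw [Submodule.span_le]
    rintro _ ⟨a, ha, rfl⟩
    exact ⟨_, diff_gen ha⟩

/-- The path through the whole cube at the last point of the cuboid, as an element of the last
term. -/
noncomputable def socleElt (m : ℕ) (d : Coeff k n) (i : Fin n → ℤ) (l : ℕ) : Term m d i l :=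
  path m d i (sides m i) (sides m i + 1) • gen m d i l (sides m i)

theorem inCube_sides_add_one (hn : 1 ≤ n) (hi : IsVertex m i) :
    InCube m i (sides m i) (sides m i + 1) :=
  ⟨fun t => by simp, le_rfl, by rw [shift_add_one]; exact (isPoint_sides hn hi).2⟩

theorem tcoord_smul_socleElt (hn : 1 ≤ n) (hm : 3 ≤ m) (hd : IsAdmissible m d)
    (hi : IsVertex m i) {l : ℕ} (hl : l + 1 = m) (r : k) (a c : Fin (n + 1) → ℤ) :
    tcoord m d i l ((r • (1 : StableAlg m d)) • socleElt m d i l) a c =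
      if a = sides m i ∧ c = sides m i + 1 then r else 0 := by
  have hmem : sides m i ∈ cuboidNet m i l := by rw [cuboidNet_last hn hi hl]; simp
  have hp := isPoint_sides hn hi
  have hcomp : comp m d i l a ((r • (1 : StableAlg m d)) • socleElt m d i l) =
      if a = sides m i then r • path m d i (sides m i) (sides m i + 1) else 0 := by
    rw [socleElt, smul_smul, smul_one_mul, map_smul, comp_gen _ a hmem]
    split_ifs with ha
    · rw [smul_eq_mul, smul_mul_assoc, mul_idem_of_mem (path_mem_proj hn hm hd hp _)]
    · rw [smul_zero]
  rw [tcoord, hcomp]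
  by_cases ha : a = sides m i
  · subst ha
    rw [if_pos rfl, map_smul, coord_path hn hm hd hi hp (inCube_sides_add_one hn hi),
      Finsupp.smul_apply, Finsupp.single_apply, smul_eq_mul]
    simp [eq_comm]
  · rw [if_neg ha, if_neg (fun h => ha h.1), map_zero, Finsupp.zero_apply]

theorem tcoord_sub {l : ℕ} (x y : Term m d i l) (a c : Fin (n + 1) → ℤ) :
    tcoord m d i l (x - y) a c = tcoord m d i l x a c - tcoord m d i l y a c := by
  rw [tcoord, map_sub, map_sub, Finsupp.sub_apply]
  rfl

theorem tcoord_zero {l : ℕ} (a c : Fin (n + 1) → ℤ) :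
    tcoord m d i l (0 : Term m d i l) a c = 0 := by
  rw [tcoord, map_zero, map_zero, Finsupp.zero_apply]

/-- The kernel of the last differential is one-dimensional. -/
theorem mem_ker_diff_last_iff (hn : 1 ≤ n) (hm : 3 ≤ m) (hd : IsAdmissible m d)
    (hi : IsVertex m i) {l : ℕ} (hl : l + 2 = m) (x : Term m d i (l + 1)) :
    x ∈ LinearMap.ker (diff m d i l) ↔
      ∃ r : k, x = (r • (1 : StableAlg m d)) • socleElt m d i (l + 1) := by
  have hsocle : ∀ r : k, diff m d i l ((r • (1 : StableAlg m d)) • socleElt m d i (l + 1)) = 0 := by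
    intro r
    refine tcoord_ext hn hm hd hi fun a ha c hc => ?_
    rw [tcoord_diff hn hm hd hi _ ha hc, tcoord_zero]
    refine Finset.sum_eq_zero fun t _ => ?_
    rw [tcoord_smul_socleElt hn hm hd hi hl, if_neg, mul_zero]
    rintro ⟨h1, h2⟩
    have h3 : c t ≤ a t + 1 := hc.2.1 t
    rw [h2, ← h1] at h3
    simp [basisVec_apply] at h3
  constructor
  · intro hx
    refine ⟨tcoord m d i (l + 1) x (sides m i) (sides m i + 1), ?_⟩
    set x' := x - (tcoord m d i (l + 1) x (sides m i) (sides m i + 1) • (1 : StableAlg m d)) •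
      socleElt m d i (l + 1) with hx'
    have hker : diff m d i l x' = 0 := by
      rw [hx', map_sub, LinearMap.mem_ker.1 hx, hsocle, sub_zero]
    -- the other coordinates contract, so `x'` is the image of the term after the last one
    obtain ⟨y, hy⟩ : ∃ y, diff m d i (l + 1) y = x' := by
      refine exists_diff_eq hn hm hd hi x' (fun l' h a ha c hc => ?_) ?_
      · obtain rfl : l' = l := by omega
        rw [← tcoord_diff hn hm hd hi x' ha hc, hker, tcoord_zero]
      · intro a ha c hc hfree
        obtain ⟨rfl, rfl⟩ | ⟨rfl, rfl⟩ := eq_zero_or_eq_sides hn (mem_cuboidNet.1 ha).1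
          (mem_cuboidNet.1 ha).2.1 hc hfree
        · have := (mem_cuboidNet.1 ha).2.2
          simp at this
          omega
        · rw [hx', tcoord_sub, tcoord_smul_socleElt hn hm hd hi hl, if_pos ⟨rfl, rfl⟩, sub_self]
    have hy0 : y = 0 := by
      refine term_ext fun a ha => ?_
      exfalso
      have h1 := mem_cuboidNet.1 ha
      have h2 := Finset.sum_le_sum fun t (_ : t ∈ Finset.univ) => h1.2.1 t
      rw [sum_sides, h1.2.2] at h2
      push_cast at h2
      omega
    rw [hy0, map_zero] at hy
    exact sub_eq_zero.1 (hx'.symm.trans hy.symm)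
  · rintro ⟨r, rfl⟩
    exact hsocle r

theorem isSuperfluous_ker_augmentation (hn : 1 ≤ n) (hm : 3 ≤ m) (hd : IsAdmissible m d)
    (hi : IsVertex m i) : IsSuperfluous (LinearMap.ker (augmentation m d i)) := by
  refine isSuperfluous_of_tcoord_self hn hm hd hi _ fun x hx a ha => ?_
  rw [cuboidNet_zero hn hi, Finset.mem_singleton] at ha
  subst ha
  exact (mem_ker_augmentation_iff hn hm hd hi x).1 hx

theorem isSuperfluous_ker_diff (hn : 1 ≤ n) (hm : 3 ≤ m) (hd : IsAdmissible m d)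
    (hi : IsVertex m i) {l : ℕ} (hl : l + 1 < m) :
    IsSuperfluous (LinearMap.ker (diff m d i l)) := by
  refine isSuperfluous_of_tcoord_self hn hm hd hi _ fun x hx a ha => ?_
  by_cases hl' : l + 2 = m
  · obtain ⟨r, rfl⟩ := (mem_ker_diff_last_iff hn hm hd hi hl' x).1 hx
    rw [tcoord_smul_socleElt hn hm hd hi hl', if_neg]
    rintro ⟨h1, h2⟩
    have := congrFun (h1.symm.trans h2) 0
    simp at this
  · rw [← range_diff_eq_ker hn hm hd hi (by omega)] at hx
    obtain ⟨y, rfl⟩ := hx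
    exact tcoord_diff_self hn hm hd hi y ha

theorem isMinimalResolutionUpTo (hn : 1 ≤ n) (hm : 3 ≤ m) (hd : IsAdmissible m d)
    (hi : IsVertex m i) :
    IsMinimalResolutionUpTo (m - 1) (augmentation m d i) (diff m d i) where
  projective l _ := projective_term l
  surjective := augmentation_surjective hn hi
  exact_zero _ := range_diff_eq_ker_augmentation hn hm hd hi
  exact_succ l hl := range_diff_eq_ker hn hm hd hi (by omega)
  minimal_zero := isSuperfluous_ker_augmentation hn hm hd hi
  minimal_succ l hl := isSuperfluous_ker_diff hn hm hd hi (by omega)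

theorem socleElt_ne_zero (hn : 1 ≤ n) (hm : 3 ≤ m) (hd : IsAdmissible m d)
    (hi : IsVertex m i) {l : ℕ} (hl : l + 1 = m) : socleElt m d i l ≠ 0 := by
  intro h
  have := tcoord_smul_socleElt hn hm hd hi hl 1 (sides m i) (sides m i + 1)
  rw [h, smul_zero, tcoord_zero, if_pos ⟨rfl, rfl⟩] at this
  exact zero_ne_one this

theorem coord_smul_projGen (hn : 1 ≤ n) (hm : 3 ≤ m) (hd : IsAdmissible m d)
    (hi : IsVertex m i) {a : Fin (n + 1) → ℤ} (ha : IsPoint m i a) (r : k) :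
    coord m d i a
      (((r • (1 : StableAlg m d)) • projGen m d (shift i a) : Proj m d (shift i a)) :
        StableAlg m d) a = r := by
  have h : (((r • (1 : StableAlg m d)) • projGen m d (shift i a) : Proj m d (shift i a)) :
      StableAlg m d) = r • path m d i a a := by
    rw [path_self ha.2]
    exact smul_one_mul r _
  rw [h, map_smul, coord_path hn hm hd hi ha (inCube_self ha.2), Finsupp.smul_apply,
    Finsupp.single_eq_same, smul_eq_mul, mul_one]

/-- The projective acts on the socle element through its simple quotient. -/
theorem smul_socleElt (hn : 1 ≤ n) (hm : 3 ≤ m) (hd : IsAdmissible m d) (hi : IsVertex m i)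
    (l : ℕ) {y : StableAlg m d} (hy : y ∈ Proj m d (shift i (sides m i))) :
    y • socleElt m d i l =
      (coord m d i (sides m i) y (sides m i) • (1 : StableAlg m d)) • socleElt m d i l := by
  have hp := isPoint_sides hn hi
  have hc := inCube_sides_add_one hn hi
  have hone : idem m d (shift i (sides m i)) * path m d i (sides m i) (sides m i + 1) =
      path m d i (sides m i) (sides m i + 1) := by
    have := idem_mul_path hn hm hd hp hc
    rwa [shift_add_one] at this
  have harrow : ∀ t, arrow m d t (shift i (sides m i)) *
      path m d i (sides m i) (sides m i + 1) = 0 := by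
    intro t
    have := arrow_mul_path hn hm hd hp hc t
    rw [shift_add_one] at this
    rw [this, path_eq_zero, smul_zero]
    intro h
    have := h.2.1 t
    simp [basisVec_apply] at this
  have hrad : ∀ z ∈ radProj m d (shift i (sides m i)),
      (z : StableAlg m d) * path m d i (sides m i) (sides m i + 1) = 0 := by
    intro z hz
    induction hz using Submodule.span_induction with
    | mem z hz =>
      obtain ⟨t, ht⟩ := hz
      rw [ht, harrow]
    | zero => rw [Submodule.coe_zero, zero_mul]
    | add x y _ _ hx hy => rw [Submodule.coe_add, add_mul, hx, hy, add_zero]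
    | smul r x _ hx => rw [Submodule.coe_smul, smul_eq_mul, mul_assoc, hx, mul_zero]
  set r := coord m d i (sides m i) y (sides m i) with hr
  have hz := (mem_radProj_iff hn hm hd hi hp rfl
    (⟨y, hy⟩ - (r • (1 : StableAlg m d)) • projGen m d (shift i (sides m i)))).2 (by
      rw [Submodule.coe_sub, map_sub, Finsupp.sub_apply, coord_smul_projGen hn hm hd hi hp,
        ← hr, sub_self])
  have h1 := hrad _ hz
  rw [Submodule.coe_sub, Submodule.coe_smul, projGen, sub_mul, smul_eq_mul, mul_assoc, hone,
    sub_eq_zero] at h1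
  rw [socleElt, smul_smul, smul_smul, ← h1]

theorem isSimpleModule_ker_diff (hn : 1 ≤ n) (hm : 3 ≤ m) (hd : IsAdmissible m d)
    (hi : IsVertex m i) {l : ℕ} (hl : l + 2 = m) :
    IsSimpleModule (StableAlg m d) (LinearMap.ker (diff m d i l)) := by
  have hker := mem_ker_diff_last_iff (d := d) hn hm hd hi hl
  rw [isSimpleModule_iff_toSpanSingleton_surjective]
  refine ⟨⟨⟨socleElt m d i (l + 1), (hker _).2 ⟨1, by rw [one_smul, one_smul]⟩⟩, 0,
    fun h => ?_⟩, ?_⟩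
  · exact socleElt_ne_zero hn hm hd hi hl (congrArg Subtype.val h)
  · rintro ⟨x, hx⟩ hne ⟨z, hz⟩
    obtain ⟨r, rfl⟩ := (hker x).1 hx
    obtain ⟨s, rfl⟩ := (hker z).1 hz
    have hr : r ≠ 0 := by
      rintro rfl
      exact hne (Subtype.ext (show ((0 : k) • (1 : StableAlg m d)) •
        socleElt m d i (l + 1) = 0 by rw [zero_smul, zero_smul]))
    refine ⟨(s * r⁻¹) • 1, Subtype.ext ?_⟩
    rw [LinearMap.toSpanSingleton_apply, Submodule.coe_smul, smul_smul, smul_one_mul, smul_smul,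
      inv_mul_cancel_right₀ hr]

theorem nonempty_equiv_quotient {R M N : Type*} [Ring R] [AddCommGroup M] [Module R M]
    [AddCommGroup N] [Module R N] (F : M →ₗ[R] N) (hF : Function.Surjective F)
    {K : Submodule R M} (hK : LinearMap.ker F = K) : Nonempty (N ≃ₗ[R] M ⧸ K) := by
  subst hK
  exact ⟨(F.quotKerEquivOfSurjective hF).symm⟩

theorem nonempty_ker_diff_equiv (hn : 1 ≤ n) (hm : 3 ≤ m) (hd : IsAdmissible m d)
    (hi : IsVertex m i) {l : ℕ} (hl : l + 2 = m) :
    Nonempty (LinearMap.ker (diff m d i l) ≃ₗ[StableAlg m d]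
      Simple m d (shift i (sides m i))) := by
  have hker := mem_ker_diff_last_iff (d := d) hn hm hd hi hl
  have hp := isPoint_sides hn hi
  obtain ⟨F, hF⟩ : ∃ F : Proj m d (shift i (sides m i)) →ₗ[StableAlg m d]
      LinearMap.ker (diff m d i l), ∀ y, (F y : Term m d i (l + 1)) =
        (coord m d i (sides m i) y (sides m i) • (1 : StableAlg m d)) • socleElt m d i (l + 1) :=
    ⟨(LinearMap.toSpanSingleton (StableAlg m d) _ ⟨socleElt m d i (l + 1),
      (hker _).2 ⟨1, by rw [one_smul, one_smul]⟩⟩).comp (Proj m d _).subtype,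
      fun y => smul_socleElt hn hm hd hi (l + 1) y.2⟩
  have hsurj : Function.Surjective F := by
    rintro ⟨x, hx⟩
    obtain ⟨r, rfl⟩ := (hker x).1 hx
    refine ⟨(r • (1 : StableAlg m d)) • projGen m d _, Subtype.ext ?_⟩
    rw [hF, coord_smul_projGen hn hm hd hi hp]
  have hkerF : LinearMap.ker F = radProj m d (shift i (sides m i)) := by
    ext y
    rw [mem_radProj_iff hn hm hd hi hp rfl, LinearMap.mem_ker, ← Submodule.coe_eq_zero, hF]
    constructor
    · intro h
      have := tcoord_smul_socleElt hn hm hd hi hl (coord m d i (sides m i) y (sides m i))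
        (sides m i) (sides m i + 1)
      rw [h, tcoord_zero, if_pos ⟨rfl, rfl⟩] at this
      exact this.symm
    · intro h
      rw [h, zero_smul, zero_smul]
  have h := nonempty_equiv_quotient (R := StableAlg m d) (M := Proj m d (shift i (sides m i)))
    (N := LinearMap.ker (diff m d i l)) F hsurj
    (K := radProj m d (shift i (sides m i))) hkerF
  exact h

end Kernels

end CubicPyramid

theorem mainTheorem2 {k : Type u} [Field k] (n m : ℕ) (hn : 1 ≤ n) (hm : 3 ≤ m)
    (d : Coeff k n) (hd : IsAdmissible m d) (i : Fin n → ℤ) (hi : IsVertex m i) :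
    -- the last net of the cuboid, and its quiver vertex
    (cuboidNet m i (m - 1) = {sides m i} ∧ IsVertex m (shift i (sides m i + 1)) ∧
      shift i (sides m i + 1) = shift i (sides m i)) ∧
    ∃ (ζ : ℕ → (Fin (n + 1) → ℤ) → Fin (n + 1) → k)
      (f₀ : Term m d i 0 →ₗ[StableAlg m d] Simple m d i)
      (f : ∀ l, Term m d i (l + 1) →ₗ[StableAlg m d] Term m d i l),
      -- all indexing points are quiver vertices
      (∀ l, l < m → ∀ a ∈ cuboidNet m i l, IsVertex m (shift i a)) ∧
      -- the scalars
      (∀ l, l + 1 < m → ∀ a ∈ cuboidNet m i (l + 1), ∀ t,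
        (ζ l a t ≠ 0 ↔ a - basisVec t ∈ cuboidNet m i l)) ∧
      -- the maps on the standard generators
      f₀ (gen m d i 0 0) = Submodule.Quotient.mk (projGen m d i) ∧
      (∀ l, l + 1 < m → ∀ a ∈ cuboidNet m i (l + 1),
        idem m d (shift i a) • theta m d i l (ζ l) a = theta m d i l (ζ l) a ∧
        f l (gen m d i (l + 1) a) = theta m d i l (ζ l) a) ∧
      -- the maps have degree zero if the generators of the `l`-th term are placed in degree `l`
      (∀ l, l + 1 < m → ∀ (p : ℕ) (x : Term m d i (l + 1)),
        (∀ a, (x a : StableAlg m d) ∈ homog m d p) →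
          ∀ a, (f l x a : StableAlg m d) ∈ homog m d (p + 1)) ∧
      -- these are the first terms of a minimal projective resolution of the simple at `i`
      IsMinimalResolutionUpTo (m - 1) f₀ f ∧
      -- generators of the kernels
      LinearMap.ker f₀ = Submodule.span (StableAlg m d)
        (theta m d i 0 (ζ 0) '' (cuboidNet m i 1 : Set (Fin (n + 1) → ℤ))) ∧
      (∀ l, l + 2 < m → LinearMap.ker (f l) = Submodule.span (StableAlg m d)
        (theta m d i (l + 1) (ζ (l + 1)) ''
          (cuboidNet m i (l + 2) : Set (Fin (n + 1) → ℤ)))) ∧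
      -- the last kernel
      IsSimpleModule (StableAlg m d) (LinearMap.ker (f (m - 2))) ∧
      Nonempty (LinearMap.ker (f (m - 2)) ≃ₗ[StableAlg m d] Simple m d (shift i (sides m i))) ∧
      -- every minimal projective resolution of the simple at `i` begins in this way
      ∀ (P : ℕ → Type w) [∀ l, AddCommGroup (P l)] [∀ l, Module (StableAlg m d) (P l)]
        (g₀ : P 0 →ₗ[StableAlg m d] Simple m d i)
        (g : ∀ l, P (l + 1) →ₗ[StableAlg m d] P l),
        IsMinimalResolutionUpTo (m - 1) g₀ g →
          (∃ φ : ∀ l, Term m d i l →ₗ[StableAlg m d] P l,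
            (∀ l, l < m → Function.Bijective (φ l)) ∧ g₀ ∘ₗ φ 0 = f₀ ∧
            ∀ l, l + 1 < m → g l ∘ₗ φ (l + 1) = φ l ∘ₗ f l) ∧
          Nonempty (LinearMap.ker (g (m - 2)) ≃ₗ[StableAlg m d]
            Simple m d (shift i (sides m i))) := by
  obtain ⟨q, rfl⟩ : ∃ q, m = q + 2 := ⟨m - 2, by omega⟩
  have hb := isPoint_sides hn hi
  have hres := isMinimalResolutionUpTo hn hm hd hi
  refine ⟨⟨cuboidNet_last hn hi (by omega), ?_, shift_add_one i _⟩,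
    zeta (q + 2) d i, augmentation (q + 2) d i, diff (q + 2) d i,
    fun l _ a ha => (isPoint_of_mem hn ha).2, fun l _ a ha t => zeta_ne_zero_iff hn hd ha t,
    augmentation_gen hn hi, fun l _ a ha => ⟨idem_smul_theta l _ a, diff_gen ha⟩,
    fun l _ p x hx a => diff_mem_homog x hx a, hres, ?_, fun l hl => ?_,
    isSimpleModule_ker_diff hn hm hd hi rfl, nonempty_ker_diff_equiv hn hm hd hi rfl, ?_⟩
  · rw [shift_add_one]
    exact hb.2
  · rw [← range_diff_eq_ker_augmentation hn hm hd hi, range_diff_eq_span]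
  · rw [← range_diff_eq_ker hn hm hd hi hl, range_diff_eq_span]
  · intro P _ _ g₀ g hg
    obtain ⟨φ, hφ, hφ₀, hφc⟩ := hres.exists_iso hg
    refine ⟨⟨φ, fun l hl => hφ l (by omega), hφ₀, fun l hl => hφc l (by omega)⟩, ?_⟩
    obtain ⟨e⟩ := nonempty_ker_diff_equiv hn hm hd hi (l := q) rfl
    obtain ⟨e'⟩ := nonempty_ker_equiv (hφ q (by omega)).1 (hφ (q + 1) (by omega))
      (hφc q (by omega))
    exact ⟨e'.symm.trans e⟩
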